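/- Let $Y\subset\mathbb R^2$ be a random compact set whose distribution is isotropic (invariant under rotations about the origin) such that, for some $0<a_1<a_2$, almost surely $D(a_1)\subset Y\subset D(a_2)$, where $D(a)$ is the closed disk of radius $a$ centred at the origin, and such that almost surely $\nu(\partial Y)=0$, where $\nu$ is the Lebesgue measure on $\mathbb R^2$. Let $\tilde\gamma(\mathbf y)=E\,\nu(\mathring Y\cap(\mathbf y+\mathring Y))$ be its geometric covariogram; by isotropy it is a function of $|\mathbf y|$, also written $\tilde\gamma$. Let $\alpha>1$. For $0<r_0<r_1<\infty$, and also for $0<r_0<r_1=\infty$ if $\alpha>3$, let $X=RY$, where $R$ is independent of $Y$ and has density proportional to $r^{-\alpha}$ on $[r_0,r_1]$ (on $[r_0,\infty)$ if $r_1=\infty$). Let $\{(x_i,t_i,X_i)\}$ be a Poisson point process on $\mathbb R^2\times\mathbb R\times\mathcal F$, where $\mathcal F$ is the space of closed subsets of $\mathbb R^2$, with intensity the product of the Lebesgue measures and of the law of $X$. The visible parts of the dead leaves model $M(r_0,r_1)$ are the sets $V_i=(x_i+X_i)\setminus\bigcup_{t_j\in(t_i,0)}(x_j+\mathring X_j)$.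 Let $$p(r_0,r_1,\mathbf x)=\Pr\bigl(\exists\,t_i\le 0:\ \{0,\mathbf x\}\subset\mathring V_i\bigr)$$ be the probability that the origin and $\mathbf x$ are in the same visible part; it depends on $\mathbf x$ only through $x=|\mathbf x|$ and is also written $p(r_0,r_1,x)$. For $1<\alpha<3$ and $0<r_1<\infty$ put $p(0,r_1,x)=\lim_{r_0\downarrow0}p(r_0,r_1,x)$; this limit exists and $$p(0,r_1,x)=\frac{\int_0^{r_1}\tilde\gamma(x/u)\,u^{2-\alpha}\,du}{\int_0^{r_1}[2\tilde\gamma(0)-\tilde\gamma(x/u)]\,u^{2-\alpha}\,du}.$$ Consider the following assumptions. (H-$\gamma$1) For every $\delta>0$, $\tilde\gamma(\mathbf x)=\tilde\gamma(0)+o(|\mathbf x|^{1-\delta})$ as $\mathbf x\to0$. (H-$\gamma$2) For every unit vector $\mathbf u$, $s\mapsto\tilde\gamma(s\mathbf u)$ has a right derivative at $s=0$, whose absolute value is bounded away from $0$ and $\infty$ independently of $\mathbf u$. Under (H-$\gamma$2), let $\dot{\tilde\gamma}(0)$ be the right derivative of $s\mapsto\tilde\gamma(s)$, $s\ge0$,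 at $0$. Then: (i) If $\alpha>3$, then $p(r_0,\infty,x)=g(\alpha)(x/r_0)^{3-\alpha}(1+o(1))$ as $x/r_0\to\infty$, where $$g(\alpha)=\frac{\alpha-3}{2\tilde\gamma(0)}\int_0^\infty\tilde\gamma(1/v)\,v^{2-\alpha}\,dv<\infty .$$ (ii) If $2<\alpha<3$ and (H-$\gamma$1) holds, then $1-p(0,r_1,x)=g(\alpha)(x/r_1)^{3-\alpha}(1+o(1))$ as $x/r_1\to0$, where $$g(\alpha)=\frac{2(3-\alpha)}{\tilde\gamma(0)}\int_0^\infty(\tilde\gamma(0)-\tilde\gamma(1/v))\,v^{2-\alpha}\,dv<\infty .$$ (iii) If $\alpha=2$ and (H-$\gamma$2) holds, then $$1-p(0,r_1,x)=\frac{2\dot{\tilde\gamma}(0)}{\tilde\gamma(0)}\,\frac{x}{r_1}\log\!\Bigl(\frac{x}{r_1}\Bigr)(1+o(1))\quad\text{as }x/r_1\to0 .$$ (iv) If $1<\alpha<2$ and (H-$\gamma$2) holds, then $$1-p(0,r_1,x)=\frac{2(3-\alpha)\dot{\tilde\gamma}(0)}{(\alpha-2)\tilde\gamma(0)}\,\frac{x}{r_1}(1+o(1))\quad\text{as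 }x/r_1\to0 .$$ In all four statements $o(1)$ is a quantity that tends to $0$ with the stated limit of the ratio, uniformly in the individual values of $r_0$ (resp. $r_1$) and $\mathbf x$. -/

import Mathlib

open MeasureTheory ProbabilityTheory Filter Topology TopologicalSpace Set
open scoped Pointwise ENNReal NNReal

namespace DeadLeaves

/-- The Euclidean plane. -/
abbrev Plane := EuclideanSpace ℝ (Fin 2)

/-- The sigma-algebra on the closed subsets of the plane, generated by the hitting events
`{F | F ∩ G ≠ ∅}` with `G` open; it is the Borel sigma-algebra of the hit-or-miss (Fell) topology. -/
instance instMeasurableSpaceCloseds : MeasurableSpace (Closeds Plane) :=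
  MeasurableSpace.generateFrom
    {S | ∃ G : Set Plane, IsOpen G ∧ S = {F : Closeds Plane | ((F : Set Plane) ∩ G).Nonempty}}

/-! ### Poisson point processes -/

/-- `Φ` is a Poisson point process with intensity measure `Λ` on the probability space `(Ω, P)`:
the number of points in a measurable set `A` with `Λ A < ∞` is a Poisson variable with mean `Λ A`,
and the numbers of points in pairwise disjoint measurable sets are independent. -/
structure IsPoissonProcess {Ω Z : Type*} [MeasurableSpace Ω] [MeasurableSpace Z]
    (P : Measure Ω) (Λ : Measure Z) (Φ : Ω → Set Z) : Prop where
  measurable_count : ∀ A : Set Z, MeasurableSet A → Measurable fun ω => (Φ ω ∩ A).encard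
  map_count : ∀ A : Set Z, MeasurableSet A → Λ A ≠ ∞ →
    P.map (fun ω => (Φ ω ∩ A).encard) =
      (poissonMeasure (Λ A).toNNReal).map (fun n : ℕ => (n : ℕ∞))
  iIndepFun_count : ∀ A : ℕ → Set Z, (∀ k, MeasurableSet (A k)) → Pairwise (Function.onFun Disjoint A) →
    iIndepFun (fun k ω => (Φ ω ∩ A k).encard) P

/-! ### The dead leaves model -/

/-- A point `(x, t, X)`: position, falling time and grain. The leaf itself is `x + X`. -/
abbrev LeafPoint := Plane × ℝ × Closeds Plane

/-- The visible part of the leaf `z`: the part of `x + X` that is not covered by the open leaves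
`x' + interior X'` with falling time in `(t, 0)`. -/
def visiblePart (Φ : Set LeafPoint) (z : LeafPoint) : Set Plane :=
  (z.1 +ᵥ (z.2.2 : Set Plane)) \
    ⋃ w ∈ {w ∈ Φ | w.2.1 ∈ Ioo z.2.1 0}, (w.1 +ᵥ interior (w.2.2 : Set Plane))

/-- `Φ` is the marked Poisson process of the dead leaves model associated with a random closed set
of law `μX`: positions and times form a homogeneous Poisson process of intensity one on
`ℝ² × ℝ`, and the grains are independent with law `μX`. -/
def IsDeadLeavesProcess {Ω : Type*} [MeasurableSpace Ω] (P : Measure Ω)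
    (μX : Measure (Closeds Plane)) (Φ : Ω → Set LeafPoint) : Prop :=
  IsPoissonProcess P ((volume : Measure Plane).prod ((volume : Measure ℝ).prod μX)) Φ

/-- The probability that the compact set `K` is included in (the interior of) one visible part of
the model, among the leaves fallen up to time `0`. -/
noncomputable def visibleProb {Ω : Type*} [MeasurableSpace Ω] (P : Measure Ω)
    (Φ : Ω → Set LeafPoint) (K : Set Plane) : ℝ :=
  P.real {ω | ∃ z ∈ Φ ω, z.2.1 ≤ 0 ∧ K ⊆ interior (visiblePart (Φ ω) z)}

/-! ### The scaling grain `X = R Y` -/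

/-- The law of the scale `R`: the probability density on `[r₀, r₁]` (on `[r₀, ∞)` if `r₁ = ⊤`)
proportional to `r ^ (-α)`. -/
noncomputable def sizeLaw (α r₀ : ℝ) (r₁ : EReal) : Measure ℝ :=
  ProbabilityTheory.cond (volume.withDensity fun r : ℝ => ENNReal.ofReal (r ^ (-α)))
    {r : ℝ | r₀ ≤ r ∧ (r : EReal) ≤ r₁}

/-- The homothetic set `r F`. -/
def scale (r : ℝ) (F : Closeds Plane) : Closeds Plane :=
  ⟨r • (F : Set Plane), F.isClosed.smul₀ r⟩

/-- The law of `X = R Y`, with `R` and `Y` independent and `Y` of law `μ`. -/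
noncomputable def grainLaw (μ : Measure (Closeds Plane)) (α r₀ : ℝ) (r₁ : EReal) :
    Measure (Closeds Plane) :=
  ((sizeLaw α r₀ r₁).prod μ).map fun q => scale q.1 q.2

/-! ### Assumptions on the law `μ` of `Y` -/

/-- Almost surely `D(a₁) ⊆ Y ⊆ D(a₂)` for some `0 < a₁ < a₂`. -/
def FixedProportions (μ : Measure (Closeds Plane)) : Prop :=
  ∃ a₁ a₂ : ℝ, 0 < a₁ ∧ a₁ < a₂ ∧ ∀ᵐ F : Closeds Plane ∂μ,
    Metric.closedBall (0 : Plane) a₁ ⊆ (F : Set Plane) ∧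
      (F : Set Plane) ⊆ Metric.closedBall (0 : Plane) a₂

/-- Almost surely the topological boundary of `Y` has area zero. -/
def NullBoundary (μ : Measure (Closeds Plane)) : Prop :=
  ∀ᵐ F : Closeds Plane ∂μ, volume (frontier (F : Set Plane)) = 0

/-- The law of `Y` is invariant under the rotations around the origin. -/
def Isotropic (μ : Measure (Closeds Plane)) : Prop :=
  ∀ ρ : Plane ≃ₗᵢ[ℝ] Plane, LinearMap.det (ρ.toLinearEquiv : Plane →ₗ[ℝ] Plane) = 1 →
    μ.map (fun F : Closeds Plane => F.preimage ρ.continuous) = μ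

/-- The geometric covariogram `y ↦ E ν(int Y ∩ (y + int Y))` of `Y`. -/
noncomputable def covariogram (μ : Measure (Closeds Plane)) (y : Plane) : ℝ :=
  ∫ F : Closeds Plane, volume.real (interior (F : Set Plane) ∩ (y +ᵥ interior (F : Set Plane))) ∂μ

/-- The covariogram as a function of the length: its value at the vector `(s, 0)`. For an isotropic
law, the covariogram at `y` depends only on `‖y‖`. -/
noncomputable def radialCovariogram (μ : Measure (Closeds Plane)) (s : ℝ) : ℝ :=
  covariogram μ (s • EuclideanSpace.single (0 : Fin 2) (1 : ℝ))

/-- The right-sided derivative at the origin of the radial covariogram. -/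
noncomputable def radialSlope (μ : Measure (Closeds Plane)) : ℝ :=
  derivWithin (radialCovariogram μ) (Ici 0) 0

/-- For every `δ > 0`, the covariogram satisfies `γ(x) = γ(0) + o(|x| ^ (1 - δ))` as `x → 0`. -/
def HGamma1 (μ : Measure (Closeds Plane)) : Prop :=
  ∀ δ : ℝ, 0 < δ →
    (fun x : Plane => covariogram μ x - covariogram μ 0) =o[𝓝 0] fun x => ‖x‖ ^ (1 - δ)

/-- In every unit direction the covariogram has a right derivative at the origin, bounded away from
zero and infinity uniformly in the direction. -/
def HGamma2 (μ : Measure (Closeds Plane)) : Prop :=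
  ∃ d : Plane → ℝ, ∃ c C : ℝ, 0 < c ∧ ∀ u : Plane, ‖u‖ = 1 →
    HasDerivWithinAt (fun s : ℝ => covariogram μ (s • u)) (d u) (Ici 0) 0 ∧
      c ≤ |d u| ∧ |d u| ≤ C

/-! ### Limits in the ratio of a length to a scale -/

/-- Pairs `(r, x)` with `r > 0` and `‖x‖ / r → ∞`. -/
noncomputable def ratioAtTop : Filter (ℝ × Plane) :=
  comap (fun q : ℝ × Plane => ‖q.2‖ / q.1) atTop ⊓ 𝓟 {q | 0 < q.1}

/-- Pairs `(r, x)` with `r > 0`, `x ≠ 0` and `‖x‖ / r → 0`. -/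
noncomputable def ratioAtZero : Filter (ℝ × Plane) :=
  comap (fun q : ℝ × Plane => ‖q.2‖ / q.1) (𝓝[>] 0) ⊓ 𝓟 {q | 0 < q.1}

end DeadLeaves

open DeadLeaves
open scoped Asymptotics

/-!
The proof has a probabilistic and an analytic half.

The two points `0` and `x` lie in the interior of one visible part if and only if, up to a null
event, the most recent leaf that contains `0` or `x` contains both in its interior
(`DeadLeaves.visible_ae_eq_mostRecentIn`): boundaries of leaves are null, and only finitely many
leaves of a bounded time interval come near a given point. For a Poisson process that is homogeneous
in time, the most recent point of a set `C` of finite intensity lies in `A ⊆ C` with probability the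
ratio of the intensities (`DeadLeaves.measureReal_mostRecentIn`); cutting time into slices of
length `h` gives two geometric series around this ratio, and they agree as `h → 0`. The intensities
are the mean areas of the intersection and of the union of the grain and its translate. For the
grain `R Y` they are integrals of `γ(|x| / r) r ^ (2 - α)` over the range of `R`, because areas
scale by `r ^ 2` and the law of `Y` is isotropic; this is the closed form `DeadLeaves.visibleProb_eq`.

For the asymptotics only a few properties of the radial covariogram matter
(`DeadLeaves.IsRadialProfile`). The substitution `u = |x| v` turns the closed form into a function
of the ratio `w` of `|x|` to the scale. For `α > 3` the numerator is an exact power of `w` once `w`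
exceeds the diameter of the support. For `α < 3` the complement is `2 H / (Γ(0) / (3 - α) + H)` with
`H = w ^ (3 - α) K(1 / w)` and `K(T) = ∫₀ᵀ (Γ(0) - Γ(1 / v)) v ^ (2 - α) dv`
(`DeadLeaves.deficit`), so everything rests on `K(T)` for large `T`. It converges for `α > 2` if
`Γ(0) - Γ(s)` decays fast enough at `0`, and a slope `-D` of `Γ` at `0` makes it equivalent to
`∫₁ᵀ D v ^ (1 - α) dv` for `α ≤ 2`
(`DeadLeaves.IsRadialProfile.isEquivalent_deficit`), which is logarithmic for `α = 2` and a power of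
`T` for `α < 2`.
-/

namespace DeadLeaves

/-! ### Measurability of hitting events -/

/-- A continuous image of a point of the random closed set hits an open set: this event is a
countable union of products of hitting events, over bases of both topologies. -/
theorem measurableSet_exists_mem {E : Type*} [TopologicalSpace E] [SecondCountableTopology E]
    [MeasurableSpace E] [OpensMeasurableSpace E] {g : E × Plane → Plane} (hg : Continuous g)
    {G : Set Plane} (hG : IsOpen G) :
    MeasurableSet {q : E × Closeds Plane | ∃ f ∈ q.2, g (q.1, f) ∈ G} := by
  have key : {q : E × Closeds Plane | ∃ f ∈ q.2, g (q.1, f) ∈ G} =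
      ⋃ U ∈ countableBasis E, ⋃ V ∈ countableBasis Plane, ⋃ (_ : U ×ˢ V ⊆ g ⁻¹' G),
        U ×ˢ {F : Closeds Plane | ((F : Set Plane) ∩ V).Nonempty} := by
    ext ⟨e, F⟩
    simp only [mem_ofPred_eq, mem_iUnion, mem_prod, exists_prop]
    constructor
    · rintro ⟨f, hf, hfG⟩
      obtain ⟨W, hW, hmem, hWG⟩ :=
        (((isBasis_countableBasis E).prod (isBasis_countableBasis Plane)).isOpen_iff.1
          (hG.preimage hg)) (e, f) hfG
      obtain ⟨U, hU, V, hV, rfl⟩ := hW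
      exact ⟨U, hU, V, hV, hWG, hmem.1, f, hf, hmem.2⟩
    · rintro ⟨U, -, V, -, hUV, he, f, hf, hfV⟩
      exact ⟨f, hf, hUV (mk_mem_prod he hfV)⟩
  rw [key]
  refine MeasurableSet.biUnion (countable_countableBasis E) fun U hU =>
    MeasurableSet.biUnion (countable_countableBasis Plane) fun V hV =>
      MeasurableSet.iUnion fun _ => ?_
  exact (isOpen_of_mem_countableBasis hU).measurableSet.prod
    (MeasurableSpace.measurableSet_generateFrom ⟨V, isOpen_of_mem_countableBasis hV, rfl⟩)

/-- A point lies in a closed set if and only if the closed set hits all balls around it. -/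
theorem measurableSet_mem {E : Type*} [TopologicalSpace E] [SecondCountableTopology E]
    [MeasurableSpace E] [OpensMeasurableSpace E] {g : E → Plane} (hg : Continuous g) :
    MeasurableSet {q : E × Closeds Plane | g q.1 ∈ q.2} := by
  have key : {q : E × Closeds Plane | g q.1 ∈ q.2} =
      ⋂ n : ℕ, {q : E × Closeds Plane | ∃ f ∈ q.2,
        (fun q : E × Plane => f - g q.1) (q.1, f) ∈ Metric.ball (0 : Plane) (1 / (n + 1))} := by
    ext ⟨e, F⟩
    simp only [mem_ofPred_eq, mem_iInter, Metric.mem_ball, dist_zero_right]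
    constructor
    · intro h n
      exact ⟨g e, h, by simpa using by positivity⟩
    · intro h
      rw [← SetLike.mem_coe, ← F.isClosed.closure_eq, Metric.mem_closure_iff]
      intro ε hε
      obtain ⟨n, hn⟩ := exists_nat_one_div_lt hε
      obtain ⟨f, hf, hfn⟩ := h n
      exact ⟨f, hf, by rw [dist_comm, dist_eq_norm]; exact hfn.trans hn⟩
  rw [key]
  exact MeasurableSet.iInter fun n => measurableSet_exists_mem (g := fun q => q.2 - g q.1)
    (by fun_prop) Metric.isOpen_ball

/-- A closed set contains an open set as soon as it contains a countable dense part of it. -/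
theorem measurableSet_subset {V : Set Plane} (hV : IsOpen V) :
    MeasurableSet {F : Closeds Plane | V ⊆ F} := by
  have key : {F : Closeds Plane | V ⊆ F} =
      ⋂ n : ℕ, ⋂ (_ : denseSeq Plane n ∈ V), {F : Closeds Plane | denseSeq Plane n ∈ F} := by
    ext F
    simp only [mem_ofPred_eq, mem_iInter]
    refine ⟨fun h n hn => h hn, fun h => ?_⟩
    refine ((denseRange_denseSeq Plane).open_subset_closure_inter hV).trans ?_
    refine closure_minimal ?_ F.isClosed
    rintro _ ⟨hx, n, rfl⟩
    exact h n hx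
  rw [key]
  refine MeasurableSet.iInter fun n => MeasurableSet.iInter fun _ => ?_
  exact (measurableSet_mem (E := Plane) continuous_id).preimage
    (measurable_const (a := denseSeq Plane n) |>.prodMk measurable_id)

theorem measurableSet_mem_interior {E : Type*} [TopologicalSpace E] [SecondCountableTopology E]
    [MeasurableSpace E] [OpensMeasurableSpace E] {g : E → Plane} (hg : Continuous g) :
    MeasurableSet {q : E × Closeds Plane | g q.1 ∈ interior (q.2 : Set Plane)} := by
  have key : {q : E × Closeds Plane | g q.1 ∈ interior (q.2 : Set Plane)} =
      ⋃ V ∈ countableBasis Plane, (g ⁻¹' V) ×ˢ {F : Closeds Plane | V ⊆ F} := by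
    ext ⟨e, F⟩
    simp only [mem_ofPred_eq, mem_iUnion, mem_prod, exists_prop, mem_preimage]
    constructor
    · intro h
      obtain ⟨V, hV, hm, hVF⟩ := (isBasis_countableBasis Plane).isOpen_iff.1 isOpen_interior _ h
      exact ⟨V, hV, hm, hVF.trans interior_subset⟩
    · rintro ⟨V, hV, hm, hVF⟩
      exact interior_maximal hVF (isOpen_of_mem_countableBasis hV) hm
  rw [key]
  exact MeasurableSet.biUnion (countable_countableBasis Plane) fun V hV =>
    ((isOpen_of_mem_countableBasis hV).preimage hg).measurableSet.prod
      (measurableSet_subset (isOpen_of_mem_countableBasis hV))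

theorem measurable_scale : Measurable fun q : ℝ × Closeds Plane => scale q.1 q.2 := by
  refine measurable_generateFrom ?_
  rintro _ ⟨G, hG, rfl⟩
  convert measurableSet_exists_mem (E := ℝ) (g := fun q => q.1 • q.2) (by fun_prop) hG using 1
  ext ⟨r, F⟩
  simp only [mem_preimage, mem_ofPred_eq, scale, Closeds.coe_mk]
  constructor
  · rintro ⟨_, ⟨f, hf, rfl⟩, h⟩
    exact ⟨f, hf, h⟩
  · rintro ⟨f, hf, h⟩
    exact ⟨_, ⟨f, hf, rfl⟩, h⟩

theorem measurable_preimage (ρ : Plane ≃ₗᵢ[ℝ] Plane) :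
    Measurable fun F : Closeds Plane => F.preimage ρ.continuous := by
  refine measurable_generateFrom ?_
  rintro _ ⟨G, hG, rfl⟩
  refine MeasurableSpace.measurableSet_generateFrom
    ⟨ρ.symm ⁻¹' G, hG.preimage ρ.symm.continuous, ?_⟩
  ext F
  simp only [mem_preimage, mem_ofPred_eq]
  constructor
  · rintro ⟨f, hf, h⟩
    exact ⟨ρ f, hf, by simpa using h⟩
  · rintro ⟨f, hf, h⟩
    exact ⟨ρ.symm f, by simpa using hf, h⟩

/-! ### Poisson processes -/

namespace IsPoissonProcess

variable {Ω Z : Type*} [MeasurableSpace Ω] [MeasurableSpace Z] {P : Measure Ω} {Λ : Measure Z}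
  {Φ : Ω → Set Z}

theorem measure_encard_eq (h : IsPoissonProcess P Λ Φ) {A : Set Z} (hA : MeasurableSet A)
    (hfin : Λ A ≠ ∞) (n : ℕ) :
    P {ω | (Φ ω ∩ A).encard = n} =
      ENNReal.ofReal (Real.exp (-(Λ A).toReal) * (Λ A).toReal ^ n / n.factorial) := by
  have h1 : {ω | (Φ ω ∩ A).encard = n} = (fun ω => (Φ ω ∩ A).encard) ⁻¹' {(n : ℕ∞)} := rfl
  rw [h1, ← Measure.map_apply (h.measurable_count A hA) (measurableSet_singleton _),
    h.map_count A hA hfin, Measure.map_apply .of_discrete (measurableSet_singleton _)]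
  have h2 : (fun n : ℕ => (n : ℕ∞)) ⁻¹' {(n : ℕ∞)} = {n} := by
    ext m; simp
  rw [h2, poissonMeasure_singleton]
  rfl

theorem measure_inter_eq_empty (h : IsPoissonProcess P Λ Φ) {A : Set Z} (hA : MeasurableSet A)
    (hfin : Λ A ≠ ∞) :
    P {ω | Φ ω ∩ A = ∅} = ENNReal.ofReal (Real.exp (-(Λ A).toReal)) := by
  simpa using h.measure_encard_eq hA hfin 0

theorem measurableSet_inter_eq_empty (h : IsPoissonProcess P Λ Φ) {A : Set Z}
    (hA : MeasurableSet A) : MeasurableSet {ω | Φ ω ∩ A = ∅} := by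
  have := measurableSet_preimage (h.measurable_count A hA) (measurableSet_singleton 0)
  convert this using 1
  ext ω
  simp

theorem ae_inter_eq_empty [IsProbabilityMeasure P] (h : IsPoissonProcess P Λ Φ) {A : Set Z}
    (hA : MeasurableSet A) (h0 : Λ A = 0) : ∀ᵐ ω ∂P, Φ ω ∩ A = ∅ := by
  rw [ae_iff, ← prob_compl_eq_one_iff]
  · have := h.measure_inter_eq_empty hA (by simp [h0])
    simpa [h0, compl_ofPred] using this
  · exact (h.measurableSet_inter_eq_empty hA).compl

theorem ae_finite_inter (h : IsPoissonProcess P Λ Φ) {A : Set Z}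
    (hA : MeasurableSet A) (hfin : Λ A ≠ ∞) : ∀ᵐ ω ∂P, (Φ ω ∩ A).Finite := by
  have h1 : P ((fun ω => (Φ ω ∩ A).encard) ⁻¹' {⊤}) = 0 := by
    rw [← Measure.map_apply (h.measurable_count A hA) (measurableSet_singleton _),
      h.map_count A hA hfin, Measure.map_apply .of_discrete (measurableSet_singleton _)]
    have : (fun n : ℕ => (n : ℕ∞)) ⁻¹' {⊤} = ∅ := by ext m; simp
    simp [this]
  rw [ae_iff]
  convert h1 using 2
  ext ω
  simp only [mem_preimage, mem_singleton_iff, encard_eq_top_iff]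
  rfl

theorem measure_inter_nonempty_le [IsProbabilityMeasure P] (h : IsPoissonProcess P Λ Φ) {A : Set Z}
    (hA : MeasurableSet A) (hfin : Λ A ≠ ∞) : P {ω | (Φ ω ∩ A).Nonempty} ≤ Λ A := by
  have h1 : {ω | (Φ ω ∩ A).Nonempty} = {ω | Φ ω ∩ A = ∅}ᶜ := by
    ext ω; simp [nonempty_iff_ne_empty]
  rw [h1, prob_compl_eq_one_sub (h.measurableSet_inter_eq_empty hA),
    h.measure_inter_eq_empty hA hfin, ← ENNReal.ofReal_one, ← ENNReal.ofReal_sub _ (by positivity)]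
  conv_rhs => rw [← ENNReal.ofReal_toReal hfin]
  refine ENNReal.ofReal_le_ofReal ?_
  linarith [Real.add_one_le_exp (-(Λ A).toReal)]

theorem indepFun_encard (h : IsPoissonProcess P Λ Φ) {A B : Set Z}
    (hA : MeasurableSet A) (hB : MeasurableSet B) (hAB : Disjoint A B) :
    IndepFun (fun ω => (Φ ω ∩ A).encard) (fun ω => (Φ ω ∩ B).encard) P := by
  have := (h.iIndepFun_count (fun k => if k = 0 then A else if k = 1 then B else ∅)
    (fun k => by split_ifs <;> simp [*]) ?_).indepFun (zero_ne_one)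
  · simpa using this
  · intro i j hij
    simp only [Function.onFun]
    split_ifs <;> simp_all [hAB.symm]

theorem measure_encard_inter_encard (h : IsPoissonProcess P Λ Φ) {A B : Set Z}
    (hA : MeasurableSet A) (hB : MeasurableSet B) (hAB : Disjoint A B) (s t : Set ℕ∞) :
    P {ω | (Φ ω ∩ A).encard ∈ s ∧ (Φ ω ∩ B).encard ∈ t} =
      P {ω | (Φ ω ∩ A).encard ∈ s} * P {ω | (Φ ω ∩ B).encard ∈ t} :=
  (h.indepFun_encard hA hB hAB).measure_inter_preimage_eq_mul s t
    (MeasurableSet.of_discrete) (MeasurableSet.of_discrete)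

end IsPoissonProcess

/-! ### The most recent point of a space-time Poisson process -/

section MostRecent

variable {Ω X M : Type*} [MeasurableSpace Ω] [MeasurableSpace X] [MeasurableSpace M]

/-- The points `(x, t, m)` with time `t` in `I` and position and mark `(x, m)` in `S`. -/
def slab (I : Set ℝ) (S : Set (X × M)) : Set (X × ℝ × M) :=
  {z | z.2.1 ∈ I ∧ (z.1, z.2.2) ∈ S}

theorem measurableSet_slab {I : Set ℝ} {S : Set (X × M)} (hI : MeasurableSet I)
    (hS : MeasurableSet S) : MeasurableSet (slab I S) :=
  (hI.preimage (by fun_prop : Measurable fun z : X × ℝ × M => z.2.1)).inter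
    (hS.preimage (by fun_prop : Measurable fun z : X × ℝ × M => (z.1, z.2.2)))

variable {μ : Measure X} {m : Measure M} [SFinite m]

theorem measure_slab {I : Set ℝ} {S : Set (X × M)} (hI : MeasurableSet I)
    (hS : MeasurableSet S) :
    (μ.prod ((volume : Measure ℝ).prod m)) (slab I S) = volume I * (μ.prod m) S := by
  rw [Measure.prod_apply (measurableSet_slab hI hS), Measure.prod_apply hS,
    ← lintegral_const_mul _ (measurable_measure_prodMk_left hS)]
  refine lintegral_congr fun x => ?_
  have : Prod.mk x ⁻¹' slab I S = I ×ˢ (Prod.mk x ⁻¹' S) := by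
    ext z; rfl
  rw [this, Measure.prod_prod]

/-- The event that the most recent point before time `0` with position and mark in `C` lies in `A`,
for `A ⊆ C`: some point in `A` has negative time and is followed by no point in `C`. -/
def mostRecentIn (Φ : Ω → Set (X × ℝ × M)) (A C : Set (X × M)) : Set Ω :=
  {ω | ∃ z ∈ Φ ω, z.2.1 < 0 ∧ (z.1, z.2.2) ∈ A ∧
    ∀ w ∈ Φ ω, w.2.1 ∈ Ioo z.2.1 0 → (w.1, w.2.2) ∉ C}

variable {P : Measure Ω} {Φ : Ω → Set (X × ℝ × M)} {A C : Set (X × M)}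

/-- Upper bound by discretisation: if time is cut in slices of length `h`, then some slice contains
a point of `A` while no more recent slice contains a point of `C`. -/
theorem measure_mostRecentIn_le [IsProbabilityMeasure P]
    (hΦ : IsPoissonProcess P (μ.prod ((volume : Measure ℝ).prod m)) Φ)
    (hA : MeasurableSet A) (hC : MeasurableSet C) (hAC : A ⊆ C) (hfin : (μ.prod m) C ≠ ∞)
    {h : ℝ} (hh : 0 < h) :
    P (mostRecentIn Φ A C) ≤
      ∑' k : ℕ, ENNReal.ofReal (Real.exp (-(((μ.prod m) C).toReal * h)) ^ k *
        (((μ.prod m) A).toReal * h)) := by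
  have hfinA : (μ.prod m) A ≠ ∞ := ((measure_mono hAC).trans_lt hfin.lt_top).ne
  have hsub : mostRecentIn Φ A C ⊆ ⋃ k : ℕ,
      {ω | (Φ ω ∩ slab (Ico (-(k * h)) 0) C).encard ∈ ({0} : Set ℕ∞) ∧
        (Φ ω ∩ slab (Ico (-((k + 1) * h)) (-(k * h))) A).encard ∈ ({0}ᶜ : Set ℕ∞)} := by
    rintro ω ⟨z, hz, hz0, hzA, hlast⟩
    obtain ⟨k, hk1, hk2⟩ : ∃ k : ℕ, -((k + 1) * h) ≤ z.2.1 ∧ z.2.1 < -(k * h) := by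
      have hpos : 0 < -z.2.1 / h := div_pos (neg_pos.2 hz0) hh
      obtain ⟨k, hk⟩ : ∃ k : ℕ, ⌈-z.2.1 / h⌉₊ = k + 1 :=
        Nat.exists_eq_succ_of_ne_zero (Nat.ceil_pos.2 hpos).ne'
      have h1 := (Nat.ceil_le (n := k + 1)).1 hk.le
      have h2 := (Nat.lt_ceil (n := k) (a := -z.2.1 / h)).1 (by omega)
      rw [div_le_iff₀ hh] at h1
      rw [lt_div_iff₀ hh] at h2
      push_cast at h1
      exact ⟨k, by linarith, by linarith⟩
    refine mem_iUnion.2 ⟨k, ?_, ?_⟩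
    · simp only [mem_singleton_iff, encard_eq_zero]
      rw [eq_empty_iff_forall_notMem]
      rintro w ⟨hw, hwt, hwC⟩
      exact hlast w hw ⟨hk2.trans_le hwt.1, hwt.2⟩ hwC
    · simp only [mem_compl_iff, mem_singleton_iff, encard_eq_zero, ← nonempty_iff_ne_empty]
      exact ⟨z, hz, ⟨hk1, hk2⟩, hzA⟩
  refine (measure_mono hsub).trans ((measure_iUnion_le _).trans (ENNReal.tsum_le_tsum fun k => ?_))
  have hk0 : 0 ≤ k * h := by positivity
  have hmC := measurableSet_slab (measurableSet_Ico (a := -(k * h)) (b := (0 : ℝ))) hC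
  have hmA := measurableSet_slab (measurableSet_Ico (a := -((k + 1) * h)) (b := -(k * h))) hA
  have hdisj : Disjoint (slab (Ico (-(k * h)) 0) C)
      (slab (Ico (-((k + 1) * h)) (-(k * h))) A) := by
    rw [Set.disjoint_left]
    rintro w hw hw'
    exact absurd hw'.1.2 (not_lt.2 hw.1.1)
  rw [hΦ.measure_encard_inter_encard hmC hmA hdisj,
    ENNReal.ofReal_mul (by positivity)]
  refine mul_le_mul' (le_of_eq ?_) ?_
  · have := hΦ.measure_inter_eq_empty hmC (by
      rw [measure_slab measurableSet_Ico hC]; exact ENNReal.mul_ne_top measure_Ico_lt_top.ne hfin)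
    simp only [mem_singleton_iff, encard_eq_zero, this]
    rw [measure_slab measurableSet_Ico hC, ← Real.exp_nat_mul, ENNReal.toReal_mul, Real.volume_Ico,
      ENNReal.toReal_ofReal (by linarith)]
    congr 2; ring
  · have h1 : (μ.prod ((volume : Measure ℝ).prod m))
        (slab (Ico (-((k + 1) * h)) (-(k * h))) A) =
          ENNReal.ofReal (((μ.prod m) A).toReal * h) := by
      rw [measure_slab measurableSet_Ico hA, Real.volume_Ico, mul_comm,
        ENNReal.ofReal_mul ENNReal.toReal_nonneg, ENNReal.ofReal_toReal hfinA]
      congr 2; ring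
    have := hΦ.measure_inter_nonempty_le hmA (by rw [h1]; exact ENNReal.ofReal_ne_top)
    rw [h1] at this
    simpa only [mem_compl_iff, mem_singleton_iff, encard_eq_zero,
      ← nonempty_iff_ne_empty] using this

/-- Lower bound by discretisation: the events that a given slice contains exactly one point of `A`
and no other point of `C`, while no more recent slice contains a point of `C`, are disjoint. -/
theorem le_measure_mostRecentIn
    (hΦ : IsPoissonProcess P (μ.prod ((volume : Measure ℝ).prod m)) Φ)
    (hA : MeasurableSet A) (hC : MeasurableSet C) (hAC : A ⊆ C) (hfin : (μ.prod m) C ≠ ∞)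
    {h : ℝ} (hh : 0 < h) :
    ∑' k : ℕ, ENNReal.ofReal (Real.exp (-(((μ.prod m) C).toReal * h)) ^ (k + 1) *
        (((μ.prod m) A).toReal * h)) ≤ P (mostRecentIn Φ A C) := by
  have hfinA : (μ.prod m) A ≠ ∞ := ((measure_mono hAC).trans_lt hfin.lt_top).ne
  set S : ℕ → Set (X × ℝ × M) := fun k =>
    slab (Ico (-(k * h)) 0) C ∪ slab (Ico (-((k + 1) * h)) (-(k * h))) (C \ A) with hS
  set T : ℕ → Set (X × ℝ × M) := fun k => slab (Ico (-((k + 1) * h)) (-(k * h))) A with hT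
  set G : ℕ → Set Ω := fun k =>
    {ω | (Φ ω ∩ S k).encard ∈ ({0} : Set ℕ∞) ∧ (Φ ω ∩ T k).encard ∈ ({1} : Set ℕ∞)} with hG
  have hmS : ∀ k, MeasurableSet (S k) := fun k =>
    (measurableSet_slab measurableSet_Ico hC).union
      (measurableSet_slab measurableSet_Ico (hC.diff hA))
  have hmT : ∀ k, MeasurableSet (T k) := fun k => measurableSet_slab measurableSet_Ico hA
  have hsub : ⋃ k, G k ⊆ mostRecentIn Φ A C := by
    refine iUnion_subset fun k ω hω => ?_
    obtain ⟨h0, h1⟩ := hω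
    simp only [mem_singleton_iff, encard_eq_zero, encard_eq_one] at h0 h1
    obtain ⟨z, hz⟩ := h1
    have hzm : z ∈ Φ ω ∩ T k := by rw [hz]; rfl
    have hk0 : 0 ≤ k * h := by positivity
    refine ⟨z, hzm.1, lt_of_lt_of_le hzm.2.1.2 (by linarith), hzm.2.2, fun w hw hwt hwC => ?_⟩
    rcases le_or_gt (-(k * h)) w.2.1 with hle | hlt
    · exact (eq_empty_iff_forall_notMem.1 h0 w) ⟨hw, Or.inl ⟨⟨hle, hwt.2⟩, hwC⟩⟩
    · have hwI : w.2.1 ∈ Ico (-((k + 1) * h)) (-(k * h)) := ⟨hzm.2.1.1.trans hwt.1.le, hlt⟩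
      by_cases hwA : (w.1, w.2.2) ∈ A
      · have : w ∈ Φ ω ∩ T k := ⟨hw, hwI, hwA⟩
        rw [hz, mem_singleton_iff] at this
        exact absurd hwt.1 (by rw [this]; exact lt_irrefl _)
      · exact (eq_empty_iff_forall_notMem.1 h0 w) ⟨hw, Or.inr ⟨hwI, hwC, hwA⟩⟩
  have hdisjG : Pairwise (Function.onFun Disjoint G) := by
    refine (pairwise_disjoint_on G).2 fun j k hjk => ?_
    rw [Set.disjoint_left]
    rintro ω ⟨-, hj⟩ ⟨hk, -⟩
    simp only [mem_singleton_iff, encard_eq_zero, encard_eq_one] at hj hk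
    obtain ⟨z, hz⟩ := hj
    have hzm : z ∈ Φ ω ∩ T j := by rw [hz]; rfl
    have h1 : ((j : ℝ) + 1) * h ≤ k * h := by
      gcongr; exact_mod_cast hjk
    have h2 : 0 ≤ j * h := by positivity
    exact (eq_empty_iff_forall_notMem.1 hk z) ⟨hzm.1, Or.inl ⟨⟨by linarith [hzm.2.1.1],
      by linarith [hzm.2.1.2]⟩, hAC hzm.2.2⟩⟩
  have hmG : ∀ k, MeasurableSet (G k) := fun k =>
    (measurableSet_preimage (hΦ.measurable_count _ (hmS k)) .of_discrete).inter
      (measurableSet_preimage (hΦ.measurable_count _ (hmT k)) .of_discrete)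
  refine le_trans (le_of_eq ?_) (measure_mono hsub)
  rw [measure_iUnion hdisjG hmG]
  refine tsum_congr fun k => ?_
  have hk0 : 0 ≤ k * h := by positivity
  have hdisj : Disjoint (S k) (T k) := by
    rw [Set.disjoint_left]
    rintro w (hw | hw) hw'
    · exact absurd hw'.1.2 (not_lt.2 hw.1.1)
    · exact hw.2.2 hw'.2
  have hle : ((μ.prod m) A).toReal ≤ ((μ.prod m) C).toReal :=
    ENNReal.toReal_mono hfin (measure_mono hAC)
  have hΛS : (μ.prod ((volume : Measure ℝ).prod m)) (S k) = ENNReal.ofReal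
      (k * h * ((μ.prod m) C).toReal + h * (((μ.prod m) C).toReal - ((μ.prod m) A).toReal)) := by
    rw [hS, measure_union _ (measurableSet_slab measurableSet_Ico (hC.diff hA)),
      measure_slab measurableSet_Ico hC, measure_slab measurableSet_Ico (hC.diff hA),
      measure_sdiff hAC hA.nullMeasurableSet hfinA, ENNReal.ofReal_add (by positivity)
      (mul_nonneg hh.le (sub_nonneg.2 hle)), ENNReal.ofReal_mul hk0, ENNReal.ofReal_mul hh.le,
      ENNReal.ofReal_sub _ ENNReal.toReal_nonneg, ENNReal.ofReal_toReal hfin,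
      ENNReal.ofReal_toReal hfinA, Real.volume_Ico, Real.volume_Ico]
    · congr 3 <;> ring
    · rw [Set.disjoint_left]
      rintro w hw hw'
      exact absurd hw'.1.2 (not_lt.2 hw.1.1)
  have hΛT : (μ.prod ((volume : Measure ℝ).prod m)) (T k) =
      ENNReal.ofReal (h * ((μ.prod m) A).toReal) := by
    rw [hT, measure_slab measurableSet_Ico hA, ENNReal.ofReal_mul hh.le,
      ENNReal.ofReal_toReal hfinA, Real.volume_Ico]
    congr 2; ring
  have e0 := hΦ.measure_encard_eq (hmS k) (by rw [hΛS]; simp) 0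
  have e1 := hΦ.measure_encard_eq (hmT k) (by rw [hΛT]; simp) 1
  simp only [Nat.cast_zero, Nat.cast_one] at e0 e1
  rw [hG, hΦ.measure_encard_inter_encard (hmS k) (hmT k) hdisj]
  simp only [mem_singleton_iff]
  rw [e0, e1, hΛS, hΛT, ENNReal.toReal_ofReal (r := h * _) (by positivity),
    ENNReal.toReal_ofReal (add_nonneg (by positivity) (mul_nonneg hh.le (sub_nonneg.2 hle))),
    ← ENNReal.ofReal_mul (by positivity), ← Real.exp_nat_mul]
  congr 1
  simp only [pow_zero, pow_one, Nat.factorial, Nat.cast_one, mul_one, div_one]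
  have hsplit : Real.exp ((k + 1 : ℕ) * -(((μ.prod m) C).toReal * h)) =
      Real.exp (-(k * h * ((μ.prod m) C).toReal +
        h * (((μ.prod m) C).toReal - ((μ.prod m) A).toReal))) *
      Real.exp (-(h * ((μ.prod m) A).toReal)) := by
    rw [← Real.exp_add]
    congr 1
    push_cast; ring
  rw [hsplit]
  ring

/-- The most recent point of `C` lies in `A` with probability the ratio of the intensities: the
two bounds for slices of length `h` differ by a factor `exp (-bh)`, and tend to the ratio. -/
theorem measureReal_mostRecentIn [IsProbabilityMeasure P]
    (hΦ : IsPoissonProcess P (μ.prod ((volume : Measure ℝ).prod m)) Φ)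
    (hA : MeasurableSet A) (hC : MeasurableSet C) (hAC : A ⊆ C) (hfin : (μ.prod m) C ≠ ∞)
    (hpos : (μ.prod m) C ≠ 0) :
    P.real (mostRecentIn Φ A C) = (μ.prod m).real A / (μ.prod m).real C := by
  set a := (μ.prod m).real A with ha
  set b := (μ.prod m).real C with hb
  have hb0 : 0 < b := ENNReal.toReal_pos hpos hfin
  have ha0 : 0 ≤ a := measureReal_nonneg
  have hgeom : ∀ h : ℝ, 0 < h →
      HasSum (fun k : ℕ => Real.exp (-(b * h)) ^ k * (a * h))
        (a * h / (1 - Real.exp (-(b * h)))) := by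
    intro h hh
    have : Real.exp (-(b * h)) < 1 := Real.exp_lt_one_iff.2 (neg_lt_zero.2 (mul_pos hb0 hh))
    rw [div_eq_inv_mul]
    exact (hasSum_geometric_of_lt_one (Real.exp_nonneg _) this).mul_right (a * h)
  have hup : ∀ h : ℝ, 0 < h → P.real (mostRecentIn Φ A C) ≤ a * h / (1 - Real.exp (-(b * h))) := by
    intro h hh
    have h1 := measure_mostRecentIn_le hΦ hA hC hAC hfin hh
    have h2 : (0 : ℝ) ≤ a * h / (1 - Real.exp (-(b * h))) :=
      (hgeom h hh).nonneg fun k => by positivity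
    refine ENNReal.toReal_le_of_le_ofReal h2 (h1.trans (le_of_eq ?_))
    rw [← (hgeom h hh).tsum_eq]
    exact (ENNReal.ofReal_tsum_of_nonneg (fun k => by positivity) (hgeom h hh).summable).symm
  have hlow : ∀ h : ℝ, 0 < h → Real.exp (-(b * h)) * (a * h / (1 - Real.exp (-(b * h)))) ≤
      P.real (mostRecentIn Φ A C) := by
    intro h hh
    have h1 := le_measure_mostRecentIn hΦ hA hC hAC hfin hh
    have hs := (hgeom h hh).mul_left (Real.exp (-(b * h)))
    rw [measureReal_def, ← ENNReal.ofReal_le_iff_le_toReal (measure_ne_top _ _), ← hs.tsum_eq,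
      ENNReal.ofReal_tsum_of_nonneg (fun k => by positivity) hs.summable]
    refine le_trans (le_of_eq (tsum_congr fun k => ?_)) h1
    congr 1
    rw [pow_succ]
    simp only [← measureReal_def, ← ha, ← hb]
    ring
  have hexp : Tendsto (fun h : ℝ => Real.exp (-(b * h))) (𝓝[>] 0) (𝓝 1) := by
    have : Continuous fun h : ℝ => Real.exp (-(b * h)) := by fun_prop
    simpa using (this.tendsto 0).mono_left nhdsWithin_le_nhds
  have hlim : Tendsto (fun h : ℝ => a * h / (1 - Real.exp (-(b * h)))) (𝓝[>] 0) (𝓝 (a / b)) := by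
    have hd : HasDerivAt (fun h : ℝ => 1 - Real.exp (-(b * h))) b 0 := by
      have := (((hasDerivAt_id (0 : ℝ)).const_mul b).neg.exp).const_sub 1
      simpa using this
    have hd' := (hasDerivAt_iff_tendsto_slope.1 hd).mono_left
      (nhdsWithin_mono 0 (fun h (hh : 0 < h) => hh.ne'))
    refine ((hd'.inv₀ hb0.ne').const_mul a).congr' ?_
    filter_upwards [self_mem_nhdsWithin] with h hh
    have hh' : h ≠ 0 := (mem_Ioi.1 hh).ne'
    simp [slope, div_eq_mul_inv, mul_assoc, mul_comm h]
  refine le_antisymm (ge_of_tendsto hlim ?_) (le_of_tendsto (by simpa using hexp.mul hlim) ?_)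
  · filter_upwards [self_mem_nhdsWithin] with h hh using hup h hh
  · filter_upwards [self_mem_nhdsWithin] with h hh using hlow h hh

end MostRecent

/-! ### Two points in the same visible part -/

/-- The pairs `(y, F)` such that the leaf `y + F` contains `p`. -/
def leafAt (p : Plane) : Set (Plane × Closeds Plane) := {q | p - q.1 ∈ q.2}

/-- The pairs `(y, F)` such that the open leaf `y + interior F` contains `p`. -/
def openLeafAt (p : Plane) : Set (Plane × Closeds Plane) :=
  {q | p - q.1 ∈ interior (q.2 : Set Plane)}

/-- The pairs `(y, F)` such that the leaf `y + F` meets the open ball of radius `c` around `0`. -/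
def leafMeetsBall (c : ℝ) : Set (Plane × Closeds Plane) :=
  {q | ∃ f ∈ q.2, q.1 + f ∈ Metric.ball (0 : Plane) c}

theorem openLeafAt_subset_leafAt (p : Plane) : openLeafAt p ⊆ leafAt p :=
  fun q hq => interior_subset (s := (q.2 : Set Plane)) hq

theorem measurableSet_leafAt (p : Plane) : MeasurableSet (leafAt p) :=
  measurableSet_mem (g := fun y => p - y) (by fun_prop)

theorem measurableSet_openLeafAt (p : Plane) : MeasurableSet (openLeafAt p) :=
  measurableSet_mem_interior (g := fun y => p - y) (by fun_prop)

theorem measurableSet_leafMeetsBall (c : ℝ) : MeasurableSet (leafMeetsBall c) :=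
  measurableSet_exists_mem (g := fun q => q.1 + q.2) (by fun_prop) Metric.isOpen_ball

theorem leafAt_subset_leafMeetsBall {p : Plane} {c : ℝ} (h : ‖p‖ < c) :
    leafAt p ⊆ leafMeetsBall c :=
  fun q hq => ⟨p - q.1, hq, by simpa using h⟩

theorem mem_vadd_iff_sub_mem (p y : Plane) (S : Set Plane) : p ∈ y +ᵥ S ↔ p - y ∈ S := by
  rw [mem_vadd_set_iff_neg_vadd_mem, vadd_eq_add, neg_add_eq_sub]

variable {m : Measure (Closeds Plane)} [SFinite m]

/-- A fixed point lies on the boundary of no leaf, if the grain has a null boundary. -/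
theorem measure_leafAt_diff_openLeafAt
    (hm : ∀ᵐ F : Closeds Plane ∂m, volume (frontier (F : Set Plane)) = 0) (p : Plane) :
    ((volume : Measure Plane).prod m) (leafAt p \ openLeafAt p) = 0 := by
  rw [Measure.prod_apply_symm ((measurableSet_leafAt p).diff (measurableSet_openLeafAt p))]
  refine (lintegral_congr_ae ?_).trans lintegral_zero
  filter_upwards [hm] with F hF
  have h1 : (fun y => (y, F)) ⁻¹' (leafAt p \ openLeafAt p) =
      (fun y => p - y) ⁻¹' (frontier (F : Set Plane)) := by
    rw [F.isClosed.frontier_eq]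
    rfl
  have h2 := (Measure.measurePreserving_sub_left (volume : Measure Plane) p).measure_preimage
    (isClosed_frontier (s := (F : Set Plane))).measurableSet.nullMeasurableSet
  rw [h1, h2, hF]

/-- Up to a null event, `0` and `x` are interior to one visible part if and only if the most recent
leaf that contains `0` or `x` contains both in its interior. -/
theorem visible_ae_eq_mostRecentIn {Ω : Type*} [MeasurableSpace Ω] {P : Measure Ω}
    [IsProbabilityMeasure P] {Φ : Ω → Set LeafPoint} (hΦ : IsDeadLeavesProcess P m Φ)
    (hm : ∀ᵐ F : Closeds Plane ∂m, volume (frontier (F : Set Plane)) = 0)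
    (hfin : ∀ c : ℝ, ((volume : Measure Plane).prod m) (leafMeetsBall c) ≠ ∞) (x : Plane) :
    {ω | ∃ z ∈ Φ ω, z.2.1 ≤ 0 ∧ {0, x} ⊆ interior (visiblePart (Φ ω) z)} =ᵐ[P]
      mostRecentIn Φ (openLeafAt 0 ∩ openLeafAt x) (leafAt 0 ∪ leafAt x) := by
  have hbd : ∀ p : Plane, ∀ᵐ ω ∂P, Φ ω ∩ slab univ (leafAt p \ openLeafAt p) = ∅ := fun p =>
    hΦ.ae_inter_eq_empty (measurableSet_slab .univ
      ((measurableSet_leafAt p).diff (measurableSet_openLeafAt p))) (by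
        rw [measure_slab .univ ((measurableSet_leafAt p).diff (measurableSet_openLeafAt p)),
          measure_leafAt_diff_openLeafAt hm, mul_zero])
  have hzero : ∀ᵐ ω ∂P, Φ ω ∩ slab {0} univ = ∅ :=
    hΦ.ae_inter_eq_empty (measurableSet_slab (measurableSet_singleton 0) .univ) (by
      rw [measure_slab (measurableSet_singleton 0) .univ, Real.volume_singleton, zero_mul])
  have hloc : ∀ᵐ ω ∂P, ∀ n : ℕ,
      (Φ ω ∩ slab (Ico (-(n : ℝ)) 0) (leafMeetsBall (‖x‖ + 1))).Finite :=
    ae_all_iff.2 fun n => hΦ.ae_finite_inter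
      (measurableSet_slab measurableSet_Ico (measurableSet_leafMeetsBall _)) (by
        rw [measure_slab measurableSet_Ico (measurableSet_leafMeetsBall _)]
        exact ENNReal.mul_ne_top measure_Ico_lt_top.ne (hfin _))
  refine eventuallyEq_set.2 ?_
  filter_upwards [hbd 0, hbd x, hzero, hloc] with ω h0 hx ht hf
  have hopen : ∀ p ∈ ({0, x} : Set Plane), ∀ w ∈ Φ ω, (w.1, w.2.2) ∈ leafAt p →
      p ∈ w.1 +ᵥ interior (w.2.2 : Set Plane) := by
    intro p hp w hw hwp
    rw [mem_vadd_iff_sub_mem]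
    by_contra hcon
    rcases hp with rfl | rfl
    · exact eq_empty_iff_forall_notMem.1 h0 w ⟨hw, mem_univ _, hwp, hcon⟩
    · exact eq_empty_iff_forall_notMem.1 hx w ⟨hw, mem_univ _, hwp, hcon⟩
  constructor
  · rintro ⟨z, hz, hzt, hzV⟩
    have hzt' : z.2.1 < 0 := lt_of_le_of_ne hzt fun h =>
      eq_empty_iff_forall_notMem.1 ht z ⟨hz, h, mem_univ _⟩
    have hzA : ∀ p ∈ ({0, x} : Set Plane), (z.1, z.2.2) ∈ openLeafAt p := by
      intro p hp
      have h1 : p ∈ interior (z.1 +ᵥ (z.2.2 : Set Plane)) := interior_mono sdiff_subset (hzV hp)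
      rw [interior_vadd, mem_vadd_iff_sub_mem] at h1
      exact h1
    have hnot : ∀ p ∈ ({0, x} : Set Plane), ∀ w ∈ Φ ω, w.2.1 ∈ Ioo z.2.1 0 →
        (w.1, w.2.2) ∉ leafAt p := by
      intro p hp w hw hwt hwp
      refine (interior_subset (hzV hp)).2 (mem_iUnion₂.2 ⟨w, ⟨hw, hwt⟩, hopen p hp w hw hwp⟩)
    refine ⟨z, hz, hzt', ⟨hzA 0 (by simp), hzA x (by simp)⟩, fun w hw hwt hwC => ?_⟩
    rcases hwC with h | h
    · exact hnot 0 (by simp) w hw hwt h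
    · exact hnot x (by simp) w hw hwt h
  · rintro ⟨z, hz, hzt, hzA, hlast⟩
    refine ⟨z, hz, hzt.le, fun p hp => ?_⟩
    have hpA : (z.1, z.2.2) ∈ openLeafAt p := by
      rcases hp with rfl | rfl
      exacts [hzA.1, hzA.2]
    have hpC : ∀ w ∈ Φ ω, w.2.1 ∈ Ioo z.2.1 0 → (w.1, w.2.2) ∉ leafAt p := by
      intro w hw hwt hwp
      refine hlast w hw hwt ?_
      rcases hp with rfl | rfl
      exacts [Or.inl hwp, Or.inr hwp]
    have hpn : ‖p‖ < ‖x‖ + 1 := by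
      rcases hp with rfl | rfl
      · rw [norm_zero]; positivity
      · linarith
    -- Only finitely many of the more recent leaves come near `p`, and they are closed.
    set W : Set LeafPoint := {w ∈ Φ ω | w.2.1 ∈ Ioo z.2.1 0 ∧
      (w.1, w.2.2) ∈ leafMeetsBall (‖x‖ + 1)} with hW
    have hWfin : W.Finite := by
      obtain ⟨n, hn⟩ := exists_nat_ge (-z.2.1)
      refine (hf n).subset fun w hw => ⟨hw.1, ⟨?_, hw.2.1.2⟩, hw.2.2⟩
      linarith [hw.2.1.1]
    have hclosed : IsClosed (⋃ w ∈ W, (w.1 +ᵥ (w.2.2 : Set Plane))) :=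
      hWfin.isClosed_biUnion fun w _ => w.2.2.isClosed.vadd w.1
    have hpK : p ∉ ⋃ w ∈ W, (w.1 +ᵥ (w.2.2 : Set Plane)) := by
      intro h
      obtain ⟨w, hw, hpw⟩ := mem_iUnion₂.1 h
      exact hpC w hw.1 hw.2.1 ((mem_vadd_iff_sub_mem _ _ _).1 hpw)
    rw [mem_interior_iff_mem_nhds]
    have h1 : z.1 +ᵥ (z.2.2 : Set Plane) ∈ 𝓝 p := by
      rw [← mem_interior_iff_mem_nhds, interior_vadd, mem_vadd_iff_sub_mem]
      exact hpA
    have h2 : Metric.ball (0 : Plane) (‖x‖ + 1) ∈ 𝓝 p :=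
      Metric.isOpen_ball.mem_nhds (by simpa using hpn)
    filter_upwards [h1, h2, hclosed.isOpen_compl.mem_nhds hpK] with p' hp1 hp2 hp3
    refine ⟨hp1, fun hp4 => hp3 ?_⟩
    obtain ⟨w, ⟨hw, hwt⟩, hpw⟩ := mem_iUnion₂.1 hp4
    have hmem : p' ∈ w.1 +ᵥ (w.2.2 : Set Plane) := vadd_set_mono interior_subset hpw
    refine mem_iUnion₂.2 ⟨w, ⟨hw, hwt, ?_⟩, hmem⟩
    exact ⟨p' - w.1, (mem_vadd_iff_sub_mem _ _ _).1 hmem, by simpa using hp2⟩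

/-- Inclusion-exclusion for the leaves that contain `0` or `x`; the null boundary makes closed and
open leaves interchangeable. -/
theorem measure_leafAt_union
    (hm : ∀ᵐ F : Closeds Plane ∂m, volume (frontier (F : Set Plane)) = 0) (x : Plane) :
    ((volume : Measure Plane).prod m) (leafAt 0 ∪ leafAt x) +
      ((volume : Measure Plane).prod m) (openLeafAt 0 ∩ openLeafAt x) =
      ((volume : Measure Plane).prod m) (openLeafAt 0) +
        ((volume : Measure Plane).prod m) (openLeafAt x) := by
  have hae : ∀ p, (leafAt p : Set (Plane × Closeds Plane)) =ᵐ[(volume : Measure Plane).prod m]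
      openLeafAt p := fun p =>
    (ae_le_set.2 (measure_leafAt_diff_openLeafAt hm p)).antisymm
      (openLeafAt_subset_leafAt p).eventuallyLE
  rw [measure_congr ((hae 0).union (hae x)), measure_union_add_inter _ (measurableSet_openLeafAt x)]

/-! ### The geometric covariogram -/

/-- The pairs `(z, F)` such that `z` lies in `interior F ∩ (y + interior F)`. Its measure is the
covariogram at `y`. -/
def overlap (y : Plane) : Set (Plane × Closeds Plane) :=
  {q | q.1 ∈ interior (q.2 : Set Plane) ∧ q.1 - y ∈ interior (q.2 : Set Plane)}

theorem measurableSet_overlap (y : Plane) : MeasurableSet (overlap y) :=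
  (measurableSet_mem_interior continuous_id).inter
    (measurableSet_mem_interior (g := fun z => z - y) (by fun_prop))

theorem overlap_section (y : Plane) (F : Closeds Plane) :
    (fun z => (z, F)) ⁻¹' overlap y =
      interior (F : Set Plane) ∩ (y +ᵥ interior (F : Set Plane)) := by
  ext z
  simp only [mem_preimage, mem_inter_iff, mem_vadd_iff_sub_mem]
  rfl

theorem overlap_subset_overlap_zero (y : Plane) : overlap y ⊆ overlap 0 :=
  fun q hq => ⟨hq.1, by simpa using hq.1⟩

theorem radialCovariogram_zero (μ : Measure (Closeds Plane)) :
    radialCovariogram μ 0 = covariogram μ 0 := by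
  simp [radialCovariogram]

section Covariogram

variable {μ : Measure (Closeds Plane)} [IsProbabilityMeasure μ]

theorem measure_overlap_ne_top (hY : FixedProportions μ) (y : Plane) :
    ((volume : Measure Plane).prod μ) (overlap y) ≠ ∞ := by
  obtain ⟨a₁, a₂, -, -, h⟩ := hY
  rw [Measure.prod_apply_symm (measurableSet_overlap y)]
  refine ((lintegral_mono_ae (g := fun _ => volume (Metric.closedBall (0 : Plane) a₂)) ?_).trans_lt
    ?_).ne
  · filter_upwards [h] with F hF
    rw [overlap_section]
    exact measure_mono (inter_subset_left.trans (interior_subset.trans hF.2))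
  · simpa using measure_closedBall_lt_top (μ := (volume : Measure Plane)) (x := 0)

theorem covariogram_eq_measureReal_overlap (hY : FixedProportions μ) (y : Plane) :
    covariogram μ y = ((volume : Measure Plane).prod μ).real (overlap y) := by
  have hm : Measurable fun F : Closeds Plane => volume ((fun z => (z, F)) ⁻¹' overlap y) :=
    measurable_measure_prodMk_right (measurableSet_overlap y)
  have hfin := measure_overlap_ne_top hY y
  rw [measureReal_def]
  rw [Measure.prod_apply_symm (measurableSet_overlap y)] at hfin ⊢
  rw [← integral_toReal hm.aemeasurable (ae_lt_top hm hfin)]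
  simp only [overlap_section]
  rfl

theorem covariogram_nonneg (hY : FixedProportions μ) (y : Plane) : 0 ≤ covariogram μ y := by
  rw [covariogram_eq_measureReal_overlap hY]
  exact measureReal_nonneg

theorem covariogram_le (hY : FixedProportions μ) (y : Plane) :
    covariogram μ y ≤ covariogram μ 0 := by
  simp only [covariogram_eq_measureReal_overlap hY]
  exact measureReal_mono (overlap_subset_overlap_zero y) (measure_overlap_ne_top hY 0)

theorem covariogram_zero_pos (hY : FixedProportions μ) : 0 < covariogram μ 0 := by
  rw [covariogram_eq_measureReal_overlap hY]
  refine ENNReal.toReal_pos (ne_of_gt ?_) (measure_overlap_ne_top hY 0)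
  obtain ⟨a₁, a₂, h0, -, h⟩ := hY
  rw [Measure.prod_apply_symm (measurableSet_overlap 0)]
  refine lt_of_lt_of_le (b := ∫⁻ _ : Closeds Plane, volume (Metric.ball (0 : Plane) a₁) ∂μ) ?_
    (lintegral_mono_ae ?_)
  · simpa using Metric.measure_ball_pos volume (0 : Plane) h0
  filter_upwards [h] with F hF
  rw [overlap_section, zero_vadd, inter_self]
  exact measure_mono (interior_maximal (Metric.ball_subset_closedBall.trans hF.1)
    Metric.isOpen_ball)

theorem measurable_covariogram (hY : FixedProportions μ) : Measurable (covariogram μ) := by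
  have hs : MeasurableSet {q : Plane × (Plane × Closeds Plane) |
      q.2.1 ∈ interior (q.2.2 : Set Plane) ∧ q.2.1 - q.1 ∈ interior (q.2.2 : Set Plane)} := by
    have h1 := (measurableSet_mem_interior (E := Plane × Plane) (g := fun e => e.2)
      (by fun_prop)).inter (measurableSet_mem_interior (E := Plane × Plane)
        (g := fun e => e.2 - e.1) (by fun_prop))
    exact h1.preimage (by fun_prop : Measurable
      fun q : Plane × (Plane × Closeds Plane) => ((q.1, q.2.1), q.2.2))
  have := (measurable_measure_prodMk_left (ν := (volume : Measure Plane).prod μ) hs).ennreal_toReal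
  convert this using 1
  ext y
  exact covariogram_eq_measureReal_overlap hY y

theorem exists_covariogram_eq_zero (hY : FixedProportions μ) :
    ∃ l : ℝ, 0 < l ∧ ∀ y : Plane, l < ‖y‖ → covariogram μ y = 0 := by
  have hY' := hY
  obtain ⟨a₁, a₂, h0, h12, h⟩ := hY'
  refine ⟨2 * a₂, by linarith, fun y hy => ?_⟩
  rw [covariogram_eq_measureReal_overlap hY, measureReal_def,
    Measure.prod_apply_symm (measurableSet_overlap y)]
  have : ∀ᵐ F : Closeds Plane ∂μ, volume ((fun z => (z, F)) ⁻¹' overlap y) = 0 := by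
    filter_upwards [h] with F hF
    convert measure_empty (μ := (volume : Measure Plane))
    rw [eq_empty_iff_forall_notMem]
    rintro z ⟨hz1, hz2⟩
    have h1 := hF.2 (interior_subset hz1)
    have h2 := hF.2 (interior_subset hz2)
    simp only [mem_closedBall_zero_iff] at h1 h2
    have h3 := norm_sub_le z (z - y)
    rw [sub_sub_cancel] at h3
    linarith
  rw [lintegral_congr_ae this]
  simp

/-- Rotations act transitively on the circles around the origin. -/
theorem exists_rotation_map_eq {x y : Plane} (h : ‖x‖ = ‖y‖) :
    ∃ ρ : Plane ≃ₗᵢ[ℝ] Plane,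
      LinearMap.det (ρ.toLinearEquiv : Plane →ₗ[ℝ] Plane) = 1 ∧ ρ x = y := by
  have : Fact (Module.finrank ℝ Plane = 2) := ⟨by simp⟩
  let o : Orientation ℝ Plane (Fin 2) := (EuclideanSpace.basisFun (Fin 2) ℝ).toBasis.orientation
  exact ⟨o.rotation (o.oangle x y), o.det_rotation _,
    (o.rotation_oangle_eq_iff_norm_eq x y).2 h⟩

theorem covariogram_rotation (hY : FixedProportions μ) (hiso : Isotropic μ) (ρ : Plane ≃ₗᵢ[ℝ] Plane)
    (hρ : LinearMap.det (ρ.toLinearEquiv : Plane →ₗ[ℝ] Plane) = 1) (y : Plane) :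
    covariogram μ (ρ y) = covariogram μ y := by
  have hm : ∀ y, Measurable fun F : Closeds Plane => volume ((fun z => (z, F)) ⁻¹' overlap y) :=
    fun y => measurable_measure_prodMk_right (measurableSet_overlap y)
  simp only [covariogram_eq_measureReal_overlap hY, measureReal_def,
    Measure.prod_apply_symm (measurableSet_overlap _)]
  congr 1
  conv_rhs => rw [← hiso ρ hρ, lintegral_map (hm y) (measurable_preimage ρ)]
  refine lintegral_congr fun F => ?_
  have h1 : (fun z => (z, F.preimage ρ.continuous)) ⁻¹' overlap y =
      ρ ⁻¹' ((fun z => (z, F)) ⁻¹' overlap (ρ y)) := by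
    ext z
    have h2 : interior (F.preimage ρ.continuous : Set Plane) = ρ ⁻¹' interior (F : Set Plane) :=
      (ρ.toHomeomorph.preimage_interior _).symm
    simp only [overlap, mem_preimage, mem_ofPred_eq, h2, map_sub]
  rw [h1, ρ.measurePreserving.measure_preimage]
  rw [overlap_section]
  exact (isOpen_interior.inter (isOpen_interior.vadd _)).measurableSet.nullMeasurableSet

theorem covariogram_eq_radialCovariogram (hY : FixedProportions μ) (hiso : Isotropic μ)
    (y : Plane) : covariogram μ y = radialCovariogram μ ‖y‖ := by
  obtain ⟨ρ, hρ, h⟩ := exists_rotation_map_eq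
    (x := ‖y‖ • EuclideanSpace.single (0 : Fin 2) (1 : ℝ)) (y := y) (by simp [norm_smul])
  rw [radialCovariogram, ← covariogram_rotation hY hiso ρ hρ (‖y‖ • _), h]

theorem measurable_radialCovariogram (hY : FixedProportions μ) :
    Measurable (radialCovariogram μ) :=
  (measurable_covariogram hY).comp (by fun_prop)

theorem radialCovariogram_nonneg (hY : FixedProportions μ) (s : ℝ) :
    0 ≤ radialCovariogram μ s :=
  covariogram_nonneg hY _

theorem radialCovariogram_le (hY : FixedProportions μ) (s : ℝ) :
    radialCovariogram μ s ≤ radialCovariogram μ 0 := by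
  rw [radialCovariogram_zero]
  exact covariogram_le hY _

theorem radialCovariogram_zero_pos (hY : FixedProportions μ) : 0 < radialCovariogram μ 0 := by
  rw [radialCovariogram_zero]
  exact covariogram_zero_pos hY

theorem exists_radialCovariogram_eq_zero (hY : FixedProportions μ) :
    ∃ l : ℝ, 0 < l ∧ ∀ s : ℝ, l < s → radialCovariogram μ s = 0 := by
  obtain ⟨l, hl, h⟩ := exists_covariogram_eq_zero hY
  refine ⟨l, hl, fun s hs => h _ ?_⟩
  simpa [norm_smul] using hs.trans_le (le_abs_self s)

end Covariogram

/-! ### The law of the scale -/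

section SizeLaw

/-- The range of the scale: `[r₀, r₁]`, or `[r₀, ∞)` if `r₁ = ⊤`. -/
def sizeRange (r₀ : ℝ) (r₁ : EReal) : Set ℝ := {r : ℝ | r₀ ≤ r ∧ (r : EReal) ≤ r₁}

theorem sizeRange_coe (r₀ r₁ : ℝ) : sizeRange r₀ (r₁ : EReal) = Icc r₀ r₁ := by
  ext r
  simp [sizeRange]

theorem sizeRange_top (r₀ : ℝ) : sizeRange r₀ ⊤ = Ici r₀ := by
  ext r
  simp [sizeRange]

theorem measurableSet_sizeRange (r₀ : ℝ) (r₁ : EReal) : MeasurableSet (sizeRange r₀ r₁) :=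
  measurableSet_Ici.inter (measurable_coe_real_ereal measurableSet_Iic)

theorem integrableOn_rpow_sizeRange {r₀ : ℝ} {r₁ : EReal} (h₀ : 0 < r₀) {β : ℝ}
    (hβ : r₁ < ⊤ ∨ β < -1) : IntegrableOn (fun r : ℝ => r ^ β) (sizeRange r₀ r₁) := by
  rcases hβ with h | h
  · have hc : ContinuousOn (fun r : ℝ => r ^ β) (Icc r₀ r₁.toReal) := fun r hr =>
      (Real.continuousAt_rpow_const r β (Or.inl (h₀.trans_le hr.1).ne')).continuousWithinAt
    refine (hc.integrableOn_Icc).mono_set fun r hr => ⟨hr.1, ?_⟩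
    simpa using EReal.toReal_le_toReal hr.2 (EReal.coe_ne_bot r) h.ne
  · exact ((integrableOn_Ici_iff_integrableOn_Ioi (by finiteness)).2
      (integrableOn_Ioi_rpow_of_lt h h₀)).mono_set fun r hr => hr.1

theorem volume_sizeRange_pos {r₀ : ℝ} {r₁ : EReal} (h₀₁ : (r₀ : EReal) < r₁) :
    0 < volume (sizeRange r₀ r₁) := by
  obtain ⟨b, hb₀, hb₁⟩ := EReal.lt_iff_exists_real_btwn.1 h₀₁
  rw [EReal.coe_lt_coe_iff] at hb₀
  exact lt_of_lt_of_le (b := volume (Ioo r₀ b)) (by simpa using hb₀)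
    (measure_mono fun r hr => ⟨hr.1.le, (EReal.coe_le_coe_iff.2 hr.2.le).trans hb₁.le⟩)

theorem setIntegral_rpow_sizeRange_pos {r₀ : ℝ} {r₁ : EReal} (h₀ : 0 < r₀)
    (h₀₁ : (r₀ : EReal) < r₁) {β : ℝ} (hβ : r₁ < ⊤ ∨ β < -1) :
    0 < ∫ r in sizeRange r₀ r₁, r ^ β := by
  have hS := measurableSet_sizeRange r₀ r₁
  rw [setIntegral_pos_iff_support_of_nonneg_ae ?_ (integrableOn_rpow_sizeRange h₀ hβ)]
  · refine (volume_sizeRange_pos h₀₁).trans_le (measure_mono fun r hr => ⟨?_, hr⟩)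
    exact (Real.rpow_pos_of_pos (h₀.trans_le hr.1) _).ne'
  · filter_upwards [ae_restrict_mem hS] with r hr
    exact Real.rpow_nonneg (h₀.le.trans hr.1) _

/-- The total mass of the density `r ^ (-α)` on the range of the scale. -/
noncomputable def sizeMass (α r₀ : ℝ) (r₁ : EReal) : ℝ≥0∞ :=
  ∫⁻ r in sizeRange r₀ r₁, ENNReal.ofReal (r ^ (-α))

variable {α r₀ : ℝ} {r₁ : EReal}

theorem sizeMass_ne_top (hα : 1 < α) (h₀ : 0 < r₀) : sizeMass α r₀ r₁ ≠ ∞ :=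
  (integrableOn_rpow_sizeRange (r₁ := r₁) h₀ (β := -α) (Or.inr (by linarith))).lintegral_lt_top.ne

theorem sizeMass_ne_zero (h₀ : 0 < r₀) (h₀₁ : (r₀ : EReal) < r₁) : sizeMass α r₀ r₁ ≠ 0 := by
  refine ne_of_gt ((setLIntegral_pos_iff (by fun_prop)).2 ?_)
  refine (volume_sizeRange_pos h₀₁).trans_le (measure_mono fun r hr => ⟨?_, hr⟩)
  have : 0 < r ^ (-α) := Real.rpow_pos_of_pos (h₀.trans_le hr.1) _
  simpa using this

theorem ae_sizeLaw_mem : ∀ᵐ r ∂sizeLaw α r₀ r₁, r ∈ sizeRange r₀ r₁ :=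
  Measure.ae_smul_measure (ae_restrict_mem (measurableSet_sizeRange r₀ r₁)) _

theorem lintegral_sizeLaw {f : ℝ → ℝ≥0∞} (hf : Measurable f) :
    ∫⁻ r, f r ∂sizeLaw α r₀ r₁ =
      (sizeMass α r₀ r₁)⁻¹ * ∫⁻ r in sizeRange r₀ r₁, ENNReal.ofReal (r ^ (-α)) * f r := by
  have hS := measurableSet_sizeRange r₀ r₁
  have hd : Measurable fun r : ℝ => ENNReal.ofReal (r ^ (-α)) := by fun_prop
  change ∫⁻ r, f r ∂(((volume.withDensity fun r : ℝ => ENNReal.ofReal (r ^ (-α)))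
    (sizeRange r₀ r₁))⁻¹ • (volume.withDensity fun r : ℝ => ENNReal.ofReal (r ^ (-α))).restrict
    (sizeRange r₀ r₁)) = _
  rw [lintegral_smul_measure, setLIntegral_withDensity_eq_setLIntegral_mul _ hd hf hS,
    withDensity_apply _ hS]
  rfl

instance : IsFiniteMeasure (sizeLaw α r₀ r₁) := by
  unfold sizeLaw
  infer_instance

theorem lintegral_sq_sizeLaw_ne_top (h₀ : 0 < r₀) (h₀₁ : (r₀ : EReal) < r₁)
    (h : r₁ < ⊤ ∨ 3 < α) : ∫⁻ r, ENNReal.ofReal (r ^ 2) ∂sizeLaw α r₀ r₁ ≠ ∞ := by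
  rw [lintegral_sizeLaw (by fun_prop)]
  refine ENNReal.mul_ne_top (ENNReal.inv_ne_top.2 (sizeMass_ne_zero h₀ h₀₁)) ?_
  have hint : IntegrableOn (fun r : ℝ => r ^ (2 - α)) (sizeRange r₀ r₁) :=
    integrableOn_rpow_sizeRange h₀ (h.imp id fun h => by linarith)
  refine ne_of_eq_of_ne (setLIntegral_congr_fun (measurableSet_sizeRange r₀ r₁) fun r hr => ?_)
    hint.lintegral_lt_top.ne
  have hr0 : 0 < r := h₀.trans_le hr.1
  rw [← ENNReal.ofReal_mul (by positivity), sub_eq_neg_add, Real.rpow_add hr0, Real.rpow_two]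

end SizeLaw

/-! ### The law of the grain -/

section GrainLaw

variable {μ : Measure (Closeds Plane)} {α r₀ : ℝ} {r₁ : EReal}

/-- The covariogram of the unnormalised scale mixture of `Y`: the integral of
`γ(|x| / r) r ^ (2 - α)` over the range of the scale. -/
noncomputable def mixedCovariogram (μ : Measure (Closeds Plane)) (α r₀ : ℝ) (r₁ : EReal) (s : ℝ) :
    ℝ :=
  ∫ r in sizeRange r₀ r₁, radialCovariogram μ (s / r) * r ^ (2 - α)

theorem mixedCovariogram_zero : mixedCovariogram μ α r₀ r₁ 0 =
    radialCovariogram μ 0 * ∫ r in sizeRange r₀ r₁, r ^ (2 - α) := by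
  simp only [mixedCovariogram, zero_div, integral_const_mul]

theorem measurableSet_volume_frontier_eq_zero :
    MeasurableSet {F : Closeds Plane | volume (frontier (F : Set Plane)) = 0} := by
  have h1 : MeasurableSet ({q : Plane × Closeds Plane | q.1 ∈ q.2} \
      {q | q.1 ∈ interior (q.2 : Set Plane)}) :=
    (measurableSet_mem continuous_id).diff (measurableSet_mem_interior continuous_id)
  have h2 := measurable_measure_prodMk_right (μ := (volume : Measure Plane)) h1
    (measurableSet_singleton 0)
  convert h2 using 1
  ext F
  rw [mem_ofPred_eq, F.isClosed.frontier_eq]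
  rfl

theorem ae_grainLaw_volume_frontier (hnull : NullBoundary μ) (h₀ : 0 < r₀) :
    ∀ᵐ F : Closeds Plane ∂grainLaw μ α r₀ r₁, volume (frontier (F : Set Plane)) = 0 := by
  rw [grainLaw, ae_map_iff measurable_scale.aemeasurable measurableSet_volume_frontier_eq_zero]
  filter_upwards [Measure.quasiMeasurePreserving_snd.ae hnull,
    Measure.quasiMeasurePreserving_fst.ae (ae_sizeLaw_mem (α := α) (r₀ := r₀) (r₁ := r₁))]
    with q hq hr
  have hr0 : q.1 ≠ 0 := (h₀.trans_le hr.1).ne'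
  have h1 : frontier (scale q.1 q.2 : Set Plane) = q.1 • frontier (q.2 : Set Plane) := by
    rw [(scale q.1 q.2).isClosed.frontier_eq, q.2.isClosed.frontier_eq, smul_set_sdiff₀ hr0,
      ← interior_smul₀ hr0]
    rfl
  rw [h1, Measure.addHaar_smul, hq, mul_zero]

variable [IsProbabilityMeasure μ]

instance : IsFiniteMeasure (grainLaw μ α r₀ r₁) := by
  unfold grainLaw
  infer_instance

theorem measure_prod_grainLaw {T : Set (Plane × Closeds Plane)} (hT : MeasurableSet T) :
    ((volume : Measure Plane).prod (grainLaw μ α r₀ r₁)) T =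
      ∫⁻ r, ∫⁻ F, volume {y | (y, scale r F) ∈ T} ∂μ ∂sizeLaw α r₀ r₁ := by
  have h1 : Measurable fun F : Closeds Plane =>
      (volume : Measure Plane) ((fun y => (y, F)) ⁻¹' T) :=
    measurable_measure_prodMk_right hT
  rw [Measure.prod_apply_symm hT, grainLaw, lintegral_map h1 measurable_scale]
  exact lintegral_prod _ (h1.comp measurable_scale).aemeasurable

theorem measure_leafMeetsBall_ne_top (hY : FixedProportions μ) (h₀ : 0 < r₀)
    (h₀₁ : (r₀ : EReal) < r₁) (h : r₁ < ⊤ ∨ 3 < α) (c : ℝ) :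
    ((volume : Measure Plane).prod (grainLaw μ α r₀ r₁)) (leafMeetsBall c) ≠ ∞ := by
  obtain ⟨a₁, a₂, ha₁, ha₁₂, hY⟩ := hY
  rw [measure_prod_grainLaw (measurableSet_leafMeetsBall c)]
  set K : ℝ := |c| / r₀ + a₂ with hK
  refine ((lintegral_mono_ae (g := fun r => (ENNReal.ofReal (K ^ 2) *
    volume (Metric.ball (0 : Plane) 1)) * ENNReal.ofReal (r ^ 2)) ?_).trans_lt ?_).ne
  · filter_upwards [ae_sizeLaw_mem (α := α) (r₀ := r₀) (r₁ := r₁)] with r hr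
    have hr0 : 0 < r := h₀.trans_le hr.1
    have hb : ∀ᵐ F ∂μ, volume {y | (y, scale r F) ∈ leafMeetsBall c} ≤
        (ENNReal.ofReal (K ^ 2) * volume (Metric.ball (0 : Plane) 1)) * ENNReal.ofReal (r ^ 2) := by
      filter_upwards [hY] with F hF
      have hsub : {y | (y, scale r F) ∈ leafMeetsBall c} ⊆
          Metric.closedBall (0 : Plane) (K * r) := by
        rintro y ⟨_, ⟨f, hf, rfl⟩, hyf⟩
        have hf' := hF.2 hf
        simp only [mem_closedBall_zero_iff, mem_ball_zero_iff] at hf' hyf ⊢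
        have h1 : ‖r • f‖ ≤ r * a₂ := by
          rw [norm_smul, Real.norm_of_nonneg hr0.le]
          gcongr
        have h2 : |c| ≤ |c| / r₀ * r := by
          rw [div_mul_eq_mul_div, le_div_iff₀ h₀]
          exact mul_le_mul_of_nonneg_left hr.1 (abs_nonneg c)
        have h3 : ‖y‖ ≤ ‖y + r • f‖ + ‖r • f‖ := norm_le_add_norm_add y (r • f)
        rw [hK, add_mul]
        change ‖y + r • f‖ < c at hyf
        linarith [le_abs_self c]
      have hK0 : 0 ≤ K * r := by
        have : 0 < a₂ := ha₁.trans ha₁₂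
        positivity
      refine (measure_mono hsub).trans (le_of_eq ?_)
      rw [Measure.addHaar_closedBall _ _ hK0, finrank_euclideanSpace_fin, mul_pow,
        ENNReal.ofReal_mul (by positivity)]
      ring
    refine (lintegral_mono_ae hb).trans (le_of_eq ?_)
    simp
  · rw [lintegral_const_mul _ (by fun_prop)]
    exact (ENNReal.mul_ne_top (ENNReal.mul_ne_top ENNReal.ofReal_ne_top measure_ball_lt_top.ne)
      (lintegral_sq_sizeLaw_ne_top h₀ h₀₁ h)).lt_top

/-- The scaling relation for the covariogram of `R Y`: the positions for which both `0` and `x` lie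
in the open leaf have mean area `E [R² γ(x / R)]`. -/
theorem measure_openLeafAt_inter (h₀ : 0 < r₀) (x : Plane) :
    ((volume : Measure Plane).prod (grainLaw μ α r₀ r₁)) (openLeafAt 0 ∩ openLeafAt x) =
      ∫⁻ r, ENNReal.ofReal (r ^ 2) *
        ((volume : Measure Plane).prod μ) (overlap (r⁻¹ • x)) ∂sizeLaw α r₀ r₁ := by
  rw [measure_prod_grainLaw ((measurableSet_openLeafAt 0).inter (measurableSet_openLeafAt x))]
  refine lintegral_congr_ae ?_
  filter_upwards [ae_sizeLaw_mem (α := α) (r₀ := r₀) (r₁ := r₁)] with r hr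
  have hr0 : r ≠ 0 := (h₀.trans_le hr.1).ne'
  rw [Measure.prod_apply_symm (measurableSet_overlap _),
    ← lintegral_const_mul _ (measurable_measure_prodMk_right (measurableSet_overlap _))]
  refine lintegral_congr fun F => ?_
  -- The positions form the image of the overlap region under `z ↦ x - r z`.
  have h1 : {y | (y, scale r F) ∈ openLeafAt 0 ∩ openLeafAt x} =
      x +ᵥ ((-r) • ((fun z => (z, F)) ⁻¹' overlap (r⁻¹ • x))) := by
    ext y
    have h2 : interior (scale r F : Set Plane) = r • interior (F : Set Plane) :=
      interior_smul₀ hr0 _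
    rw [mem_vadd_iff_sub_mem, mem_smul_set_iff_inv_smul_mem₀ (neg_ne_zero.2 hr0)]
    simp only [openLeafAt, overlap, mem_ofPred_eq, mem_inter_iff, mem_preimage, h2,
      mem_smul_set_iff_inv_smul_mem₀ hr0]
    have e1 : (-r)⁻¹ • (y - x) = r⁻¹ • (x - y) := by
      rw [inv_neg, neg_smul, ← smul_neg, neg_sub]
    have e2 : r⁻¹ • (x - y) - r⁻¹ • x = r⁻¹ • (0 - y) := by
      rw [← smul_sub]; congr 1; abel
    rw [e1, e2, and_comm]
  rw [h1, measure_vadd, Measure.addHaar_smul, finrank_euclideanSpace_fin, neg_sq,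
    abs_of_nonneg (sq_nonneg r)]

theorem measure_openLeafAt (m : Measure (Closeds Plane)) [SFinite m] (x : Plane) :
    ((volume : Measure Plane).prod m) (openLeafAt x) =
      ((volume : Measure Plane).prod m) (openLeafAt 0) := by
  rw [Measure.prod_apply_symm (measurableSet_openLeafAt x),
    Measure.prod_apply_symm (measurableSet_openLeafAt 0)]
  refine lintegral_congr fun F => ?_
  have h : ∀ p : Plane, volume ((fun y => (y, F)) ⁻¹' openLeafAt p) =
      volume (interior (F : Set Plane)) := fun p =>
    (Measure.measurePreserving_sub_left (volume : Measure Plane) p).measure_preimage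
      (isOpen_interior (s := (F : Set Plane))).measurableSet.nullMeasurableSet
  rw [h, h]

theorem measureReal_openLeafAt_inter (hY : FixedProportions μ) (hiso : Isotropic μ)
    (h₀ : 0 < r₀) (x : Plane) :
    ((volume : Measure Plane).prod (grainLaw μ α r₀ r₁)).real (openLeafAt 0 ∩ openLeafAt x) =
      (sizeMass α r₀ r₁)⁻¹.toReal * mixedCovariogram μ α r₀ r₁ ‖x‖ := by
  have hm := measurable_radialCovariogram hY
  have hov : ∀ y : Plane, ((volume : Measure Plane).prod μ) (overlap y) =
      ENNReal.ofReal (radialCovariogram μ ‖y‖) := by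
    intro y
    rw [← covariogram_eq_radialCovariogram hY hiso, covariogram_eq_measureReal_overlap hY,
      ofReal_measureReal (measure_overlap_ne_top hY y)]
  have hS := measurableSet_sizeRange r₀ r₁
  rw [measureReal_def, measure_openLeafAt_inter h₀]
  simp only [hov]
  rw [lintegral_sizeLaw (by fun_prop), ENNReal.toReal_mul, mixedCovariogram,
    integral_eq_lintegral_of_nonneg_ae ?_ (by fun_prop)]
  · congr 2
    refine setLIntegral_congr_fun hS fun r hr => ?_
    have hr0 : 0 < r := h₀.trans_le hr.1
    have e1 : ‖r⁻¹ • x‖ = ‖x‖ / r := by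
      rw [norm_smul, norm_inv, Real.norm_of_nonneg hr0.le, inv_mul_eq_div]
    have hg := radialCovariogram_nonneg hY (‖x‖ / r)
    rw [e1, ← ENNReal.ofReal_mul (by positivity), ← ENNReal.ofReal_mul (by positivity),
      sub_eq_neg_add, Real.rpow_add hr0, Real.rpow_two]
    congr 1; ring
  · filter_upwards [ae_restrict_mem hS] with r hr
    exact mul_nonneg (radialCovariogram_nonneg hY _) (Real.rpow_nonneg (h₀.le.trans hr.1) _)

/-- The probability that `0` and `x` lie in the same visible part, by the covariograms: the mean
areas of intersection and union of the leaf and its translate. -/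
theorem visibleProb_eq (hY : FixedProportions μ) (hnull : NullBoundary μ) (hiso : Isotropic μ)
    (hα : 1 < α) (h₀ : 0 < r₀) (h₀₁ : (r₀ : EReal) < r₁) (h : r₁ < ⊤ ∨ 3 < α)
    {Ω : Type*} [MeasurableSpace Ω] {P : Measure Ω} [IsProbabilityMeasure P]
    {Φ : Ω → Set LeafPoint} (hΦ : IsDeadLeavesProcess P (grainLaw μ α r₀ r₁) Φ) (x : Plane) :
    visibleProb P Φ {0, x} = mixedCovariogram μ α r₀ r₁ ‖x‖ /
      (2 * mixedCovariogram μ α r₀ r₁ 0 - mixedCovariogram μ α r₀ r₁ ‖x‖) := by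
  have hm := ae_grainLaw_volume_frontier (α := α) (r₁ := r₁) hnull h₀
  have hfin := measure_leafMeetsBall_ne_top hY h₀ h₀₁ h
  set ν := (volume : Measure Plane).prod (grainLaw μ α r₀ r₁) with hν
  have hleaf : ∀ p, ν (leafAt p) ≠ ∞ := fun p =>
    ((measure_mono (leafAt_subset_leafMeetsBall (lt_add_one ‖p‖))).trans_lt (hfin _).lt_top).ne
  have hopen : ∀ p, ν (openLeafAt p) ≠ ∞ := fun p =>
    ((measure_mono (openLeafAt_subset_leafAt p)).trans_lt (hleaf p).lt_top).ne
  have hAC : openLeafAt 0 ∩ openLeafAt x ⊆ leafAt 0 ∪ leafAt x :=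
    inter_subset_left.trans ((openLeafAt_subset_leafAt 0).trans subset_union_left)
  have hC : ν (leafAt 0 ∪ leafAt x) ≠ ∞ := measure_union_ne_top (hleaf 0) (hleaf x)
  have hz : 0 < (sizeMass α r₀ r₁)⁻¹.toReal :=
    ENNReal.toReal_pos (ENNReal.inv_ne_zero.2 (sizeMass_ne_top hα h₀))
      (ENNReal.inv_ne_top.2 (sizeMass_ne_zero h₀ h₀₁))
  have hA := measureReal_openLeafAt_inter (α := α) (r₁ := r₁) hY hiso h₀ x
  have hA0 := measureReal_openLeafAt_inter (α := α) (r₁ := r₁) hY hiso h₀ 0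
  rw [inter_self, norm_zero, ← hν] at hA0
  rw [← hν] at hA
  have hsum : ν.real (leafAt 0 ∪ leafAt x) =
      2 * ν.real (openLeafAt 0) - ν.real (openLeafAt 0 ∩ openLeafAt x) := by
    have h1 := congrArg ENNReal.toReal (measure_leafAt_union hm x)
    rw [← hν, measure_openLeafAt _ x, ← hν, ENNReal.toReal_add hC
      ((measure_mono hAC).trans_lt hC.lt_top).ne, ENNReal.toReal_add (hopen 0) (hopen 0)] at h1
    simp only [measureReal_def]
    linarith
  have hmass : 0 < mixedCovariogram μ α r₀ r₁ 0 := by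
    rw [mixedCovariogram_zero]
    exact mul_pos (radialCovariogram_zero_pos hY)
      (setIntegral_rpow_sizeRange_pos h₀ h₀₁ (h.imp id fun h => by linarith))
  have hpos : ν (leafAt 0 ∪ leafAt x) ≠ 0 := by
    intro h0
    have h1 : ν (openLeafAt 0) = 0 :=
      measure_mono_null ((openLeafAt_subset_leafAt 0).trans subset_union_left) h0
    rw [measureReal_def, h1, ENNReal.toReal_zero] at hA0
    exact (mul_pos hz hmass).ne hA0
  rw [visibleProb, measureReal_def, measure_congr (visible_ae_eq_mostRecentIn hΦ hm hfin x),
    ← measureReal_def, measureReal_mostRecentIn hΦ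
      ((measurableSet_openLeafAt 0).inter (measurableSet_openLeafAt x))
      ((measurableSet_leafAt 0).union (measurableSet_leafAt x)) hAC hC hpos, ← hν, hsum, hA, hA0,
    mul_left_comm, ← mul_sub, mul_div_mul_left _ _ hz.ne']

end GrainLaw

/-! ### Asymptotics of integrals -/

/-- Integrals of equivalent functions are equivalent, if they diverge. -/
theorem isEquivalent_intervalIntegral {f g : ℝ → ℝ} {a b : ℝ}
    (hf : ∀ s t, a ≤ s → a ≤ t → IntervalIntegrable f volume s t)
    (hg : ∀ s t, b ≤ s → b ≤ t → IntervalIntegrable g volume s t)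
    (hg0 : ∀ t, b ≤ t → 0 ≤ g t) (hfg : f ~[atTop] g)
    (hlim : Tendsto (fun T => ∫ t in b..T, g t) atTop atTop) :
    (fun T => ∫ t in a..T, f t) ~[atTop] fun T => ∫ t in b..T, g t := by
  refine Asymptotics.isLittleO_iff.2 fun c hc => ?_
  have hfg' := Asymptotics.isLittleO_iff.1 hfg (half_pos hc)
  obtain ⟨V, hV⟩ := eventually_atTop.1
    (hfg'.and ((eventually_ge_atTop a).and (eventually_ge_atTop b)))
  have hVa : a ≤ V := (hV V le_rfl).2.1
  have hVb : b ≤ V := (hV V le_rfl).2.2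
  -- The contribution `A` of the part below `V` is absorbed by the divergence of the integral.
  set A : ℝ := (∫ t in a..V, f t) - ∫ t in b..V, g t with hA
  filter_upwards [eventually_ge_atTop V, hlim.eventually_ge_atTop (2 / c * |A|)] with T hT hbig
  have hfi := hf V T hVa (hVa.trans hT)
  have hgi := hg V T hVb (hVb.trans hT)
  have hsplit : (∫ t in a..T, f t) - ∫ t in b..T, g t = A + ∫ t in V..T, (f t - g t) := by
    rw [intervalIntegral.integral_sub hfi hgi, hA,
      ← intervalIntegral.integral_add_adjacent_intervals (hf a V le_rfl hVa) hfi,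
      ← intervalIntegral.integral_add_adjacent_intervals (hg b V le_rfl hVb) hgi]
    ring
  have hG0 : 0 ≤ ∫ t in b..V, g t := intervalIntegral.integral_nonneg hVb fun t ht => hg0 t ht.1
  have hG : ∫ t in V..T, g t ≤ ∫ t in b..T, g t := by
    rw [← intervalIntegral.integral_add_adjacent_intervals (hg b V le_rfl hVb) hgi]
    linarith
  have hpos : 0 ≤ ∫ t in b..T, g t :=
    intervalIntegral.integral_nonneg (hVb.trans hT) fun t ht => hg0 t ht.1
  have h1 : ‖∫ t in V..T, (f t - g t)‖ ≤ ∫ t in V..T, c / 2 * g t := by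
    refine intervalIntegral.norm_integral_le_of_norm_le hT ?_ (hgi.const_mul _)
    filter_upwards with t ht
    have := (hV t ht.1.le).1
    rwa [Pi.sub_apply, Real.norm_of_nonneg (hg0 t (hVb.trans ht.1.le))] at this
  rw [intervalIntegral.integral_const_mul] at h1
  have h2 : |A| ≤ c / 2 * ∫ t in b..T, g t := by
    calc |A| = c / 2 * (2 / c * |A|) := by field_simp
      _ ≤ _ := by gcongr
  rw [Pi.sub_apply, hsplit, Real.norm_of_nonneg hpos]
  calc ‖A + ∫ t in V..T, (f t - g t)‖ ≤ |A| + ‖∫ t in V..T, (f t - g t)‖ := norm_add_le _ _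
    _ ≤ c / 2 * (∫ t in b..T, g t) + c / 2 * ∫ t in b..T, g t := by
        gcongr
        exact h1.trans (by gcongr)
    _ = _ := by ring

/-- The substitution `u = s v` in a scale mixture with power weight. -/
theorem integral_div_mul_rpow (F : ℝ → ℝ) {s r β : ℝ} (hs : 0 < s) (hr : 0 ≤ r) :
    ∫ u in (0 : ℝ)..r, F (s / u) * u ^ β =
      s ^ (β + 1) * ∫ v in (0 : ℝ)..(r / s), F (1 / v) * v ^ β := by
  have h := intervalIntegral.integral_comp_mul_left (a := 0) (b := r / s)
    (fun u => F (s / u) * u ^ β) hs.ne'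
  rw [mul_zero, mul_div_cancel₀ r hs.ne', smul_eq_mul, eq_inv_mul_iff_mul_eq₀ hs.ne'] at h
  rw [← h, Real.rpow_add hs, Real.rpow_one, mul_comm _ s, mul_assoc]
  refine congrArg (s * ·) ?_
  rw [← intervalIntegral.integral_const_mul]
  refine intervalIntegral.integral_congr fun v hv => ?_
  rw [uIcc_of_le (by positivity)] at hv
  rw [Real.mul_rpow hs.le hv.1, one_div, div_mul_eq_div_div, div_self hs.ne', one_div]
  ring

theorem setIntegral_Ioi_div_mul_rpow (F : ℝ → ℝ) {s r β : ℝ} (hs : 0 < s) (hr : 0 ≤ r) :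
    ∫ u in Ioi r, F (s / u) * u ^ β = s ^ (β + 1) * ∫ v in Ioi (r / s), F (1 / v) * v ^ β := by
  have h := integral_comp_mul_left_Ioi' (fun u => F (s / u) * u ^ β) (r / s) hs
  rw [mul_div_cancel₀ r hs.ne', smul_eq_mul] at h
  rw [← h, Real.rpow_add hs, Real.rpow_one, mul_comm _ s, mul_assoc]
  refine congrArg (s * ·) ?_
  rw [← integral_const_mul]
  refine setIntegral_congr_fun measurableSet_Ioi fun v hv => ?_
  have hv0 : 0 ≤ v := (show 0 ≤ r / s by positivity).trans (le_of_lt hv)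
  rw [Real.mul_rpow hs.le hv0, one_div, div_mul_eq_div_div, div_self hs.ne', one_div]
  ring

/-! ### Scale mixtures of a bounded profile -/

/-- The properties of the radial covariogram that the asymptotic analysis uses: it is bounded by its
positive value at `0` and has bounded support in `[0, ∞)`. -/
structure IsRadialProfile (Γ : ℝ → ℝ) : Prop where
  measurable : Measurable Γ
  nonneg : ∀ s, 0 ≤ Γ s
  le_zero : ∀ s, Γ s ≤ Γ 0
  zero_pos : 0 < Γ 0
  exists_eq_zero : ∃ l : ℝ, 0 < l ∧ ∀ s, l < s → Γ s = 0

/-- The integral of `(Γ(0) - Γ(1/v)) v ^ (2 - α)` from `0` to `T`. -/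
noncomputable def deficit (Γ : ℝ → ℝ) (α T : ℝ) : ℝ :=
  ∫ v in (0 : ℝ)..T, (Γ 0 - Γ (1 / v)) * v ^ (2 - α)

namespace IsRadialProfile

variable {Γ : ℝ → ℝ} {α : ℝ}

theorem sub_nonneg (hΓ : IsRadialProfile Γ) (s : ℝ) : 0 ≤ Γ 0 - Γ s :=
  _root_.sub_nonneg.2 (hΓ.le_zero s)

theorem integrableOn_mul (hΓ : IsRadialProfile Γ) {β : ℝ} {S : Set ℝ}
    (hS : MeasurableSet S) (hS0 : S ⊆ Ici 0) (s : ℝ)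
    (h : IntegrableOn (fun r : ℝ => r ^ β) S) : IntegrableOn (fun r => Γ (s / r) * r ^ β) S := by
  have hm := hΓ.measurable
  refine (h.const_mul (Γ 0)).mono' (by fun_prop) ?_
  filter_upwards [ae_restrict_mem hS] with r hr
  have hr0 : 0 ≤ r ^ β := Real.rpow_nonneg (hS0 hr) _
  rw [Real.norm_of_nonneg (mul_nonneg (hΓ.nonneg _) hr0)]
  exact mul_le_mul_of_nonneg_right (hΓ.le_zero _) hr0

theorem intervalIntegrable_mul (hΓ : IsRadialProfile Γ) (hα : α < 3) {a b : ℝ}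
    (ha : 0 ≤ a) (hb : 0 ≤ b) (s : ℝ) :
    IntervalIntegrable (fun u => Γ (s / u) * u ^ (2 - α)) volume a b := by
  have h := intervalIntegral.intervalIntegrable_rpow' (a := a) (b := b) (r := 2 - α) (by linarith)
  rw [intervalIntegrable_iff] at h ⊢
  exact hΓ.integrableOn_mul measurableSet_uIoc (fun r hr => (le_min ha hb).trans hr.1.le) s h

theorem intervalIntegrable_sub_mul (hΓ : IsRadialProfile Γ) (hα : α < 3) {a b : ℝ}
    (ha : 0 ≤ a) (hb : 0 ≤ b) (s : ℝ) :
    IntervalIntegrable (fun u => (Γ 0 - Γ (s / u)) * u ^ (2 - α)) volume a b := by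
  have h := intervalIntegral.intervalIntegrable_rpow' (a := a) (b := b) (r := 2 - α) (by linarith)
  simpa only [sub_mul] using (h.const_mul (Γ 0)).sub (hΓ.intervalIntegrable_mul hα ha hb s)

/-- For `v` close to `0` the integrand vanishes, since the profile has bounded support. -/
theorem integrableOn_Ioi (hΓ : IsRadialProfile Γ) (hα : 3 < α) :
    IntegrableOn (fun v : ℝ => Γ (1 / v) * v ^ (2 - α)) (Ioi 0) := by
  obtain ⟨l, hl, hl0⟩ := hΓ.exists_eq_zero
  have hl' : 0 < 1 / (2 * l) := by positivity
  rw [← Ioc_union_Ioi_eq_Ioi hl'.le]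
  refine IntegrableOn.union ?_ (hΓ.integrableOn_mul measurableSet_Ioi
    (fun r hr => (hl'.trans hr).le) 1 (integrableOn_Ioi_rpow_of_lt (by linarith) hl'))
  refine (integrableOn_zero (ε' := ℝ)).congr_fun (fun v hv => ?_) measurableSet_Ioc
  have h1 : 2 * l ≤ 1 / v := (le_one_div (by positivity) hv.1).2 hv.2
  rw [hl0 _ (by linarith), zero_mul]

/-- The ratio giving `p(r₀, ∞, x)` in closed form, once `x / r₀` exceeds the support. -/
theorem exists_ratio_eq_top (hΓ : IsRadialProfile Γ) (hα : 3 < α) :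
    ∃ l : ℝ, 0 < l ∧ ∀ s r₀ : ℝ, 0 < r₀ → l < s / r₀ →
    (∫ r in Ici r₀, Γ (s / r) * r ^ (2 - α)) /
        (2 * (Γ 0 * ∫ r in Ici r₀, r ^ (2 - α)) - ∫ r in Ici r₀, Γ (s / r) * r ^ (2 - α)) =
      ((∫ v in Ioi (0 : ℝ), Γ (1 / v) * v ^ (2 - α)) * (s / r₀) ^ (3 - α)) /
        (2 * Γ 0 / (α - 3) - (∫ v in Ioi (0 : ℝ), Γ (1 / v) * v ^ (2 - α)) *
          (s / r₀) ^ (3 - α)) := by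
  obtain ⟨l, hl, hl0⟩ := hΓ.exists_eq_zero
  refine ⟨l, hl, fun s r₀ hr₀ hw => ?_⟩
  have hs : 0 < s := by
    have : 0 < s / r₀ := hl.trans hw
    exact (div_pos_iff_of_pos_right hr₀).1 this
  have h3 : (2 : ℝ) - α + 1 = 3 - α := by ring
  have hJ : ∫ v in Ioi (r₀ / s), Γ (1 / v) * v ^ (2 - α) =
      ∫ v in Ioi (0 : ℝ), Γ (1 / v) * v ^ (2 - α) := by
    symm
    refine setIntegral_eq_of_subset_of_forall_sdiff_eq_zero measurableSet_Ioi
      (Ioi_subset_Ioi (div_pos hr₀ hs).le) fun v hv => ?_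
    have hv0 : 0 < v := hv.1
    have hv1 : v ≤ r₀ / s := not_lt.1 fun hlt => hv.2 hlt
    have h1 : s / r₀ ≤ 1 / v := by
      rw [le_one_div (by positivity) hv0, one_div_div]
      exact hv1
    rw [hl0 _ (hw.trans_le h1), zero_mul]
  simp only [integral_Ici_eq_integral_Ioi]
  rw [setIntegral_Ioi_div_mul_rpow Γ hs hr₀.le, hJ, integral_Ioi_rpow_of_lt (by linarith) hr₀, h3,
    Real.div_rpow hs.le hr₀.le]
  have hr : 0 < r₀ ^ (3 - α) := Real.rpow_pos_of_pos hr₀ _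
  set J := ∫ v in Ioi (0 : ℝ), Γ (1 / v) * v ^ (2 - α)
  have h4 : α - 3 ≠ 0 := by linarith
  have h5 : 3 - α ≠ 0 := by linarith
  rw [← mul_div_mul_left _ (2 * Γ 0 / (α - 3) - _) hr.ne']
  congr 1
  · field_simp
  · rw [mul_sub, ← neg_sub α 3, div_neg, neg_div, neg_neg]
    field_simp

/-- As `x / r₀ → ∞` the denominator of the closed form tends to `2 Γ(0) / (α - 3)`. -/
theorem isEquivalent_ratio_top (hΓ : IsRadialProfile Γ) (hα : 3 < α) (J : ℝ) :
    (fun w : ℝ => (J * w ^ (3 - α)) / (2 * Γ 0 / (α - 3) - J * w ^ (3 - α))) ~[atTop]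
      fun w => ((α - 3) / (2 * Γ 0) * J) * w ^ (3 - α) := by
  have h4 : 0 < α - 3 := by linarith
  have hG := hΓ.zero_pos
  have hlim : Tendsto (fun w : ℝ => w ^ (3 - α)) atTop (𝓝 0) := by
    simpa using tendsto_rpow_neg_atTop h4
  have hden : Tendsto (fun w : ℝ => 2 * Γ 0 / (α - 3) - J * w ^ (3 - α)) atTop
      (𝓝 (2 * Γ 0 / (α - 3))) := by
    simpa using (hlim.const_mul J).const_sub (2 * Γ 0 / (α - 3))
  have hc : 2 * Γ 0 / (α - 3) ≠ 0 := by positivity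
  refine Asymptotics.isEquivalent_iff_exists_eq_mul.2
    ⟨fun w => 2 * Γ 0 / (α - 3) / (2 * Γ 0 / (α - 3) - J * w ^ (3 - α)), ?_, ?_⟩
  · have := (tendsto_const_nhds (x := 2 * Γ 0 / (α - 3))).div hden hc
    rwa [div_self hc] at this
  · refine Eventually.of_forall fun w => ?_
    simp only [Pi.mul_apply]
    field_simp

theorem integral_denominator (hΓ : IsRadialProfile Γ) (hα : α < 3) {r : ℝ} (hr : 0 ≤ r) (s : ℝ) :
    ∫ u in (0 : ℝ)..r, (2 * Γ 0 - Γ (s / u)) * u ^ (2 - α) =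
      Γ 0 / (3 - α) * r ^ (3 - α) + ∫ u in (0 : ℝ)..r, (Γ 0 - Γ (s / u)) * u ^ (2 - α) := by
  have h1 := intervalIntegral.intervalIntegrable_rpow' (a := 0) (b := r) (r := 2 - α) (by linarith)
  have h2 : ∫ u in (0 : ℝ)..r, u ^ (2 - α) = r ^ (3 - α) / (3 - α) := by
    rw [integral_rpow (Or.inl (by linarith)), show (2 : ℝ) - α + 1 = 3 - α by ring,
      Real.zero_rpow (by linarith), sub_zero]
  rw [div_mul_eq_mul_div, mul_div_assoc, ← h2, ← intervalIntegral.integral_const_mul,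
    ← intervalIntegral.integral_add (h1.const_mul _)
      (hΓ.intervalIntegrable_sub_mul hα le_rfl hr s)]
  congr 1
  ext u; ring

theorem integral_denominator_pos (hΓ : IsRadialProfile Γ) (hα : α < 3) {r : ℝ}
    (hr : 0 < r) (s : ℝ) :
    0 < ∫ u in (0 : ℝ)..r, (2 * Γ 0 - Γ (s / u)) * u ^ (2 - α) := by
  rw [hΓ.integral_denominator hα hr.le]
  have h1 : 0 ≤ ∫ u in (0 : ℝ)..r, (Γ 0 - Γ (s / u)) * u ^ (2 - α) :=
    intervalIntegral.integral_nonneg hr.le fun v hv =>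
      mul_nonneg (hΓ.sub_nonneg _) (Real.rpow_nonneg hv.1 _)
  have h2 : 0 < Γ 0 / (3 - α) := div_pos hΓ.zero_pos (by linarith)
  have h3 : 0 < r ^ (3 - α) := Real.rpow_pos_of_pos hr _
  positivity

/-- The integrals over `[r₀, r₁]` converge to those over `[0, r₁]`, as `α < 3`. -/
theorem tendsto_ratio (hΓ : IsRadialProfile Γ) (hα : α < 3) {r₁ : ℝ} (hr₁ : 0 < r₁) (s : ℝ) :
    Tendsto (fun r₀ => (∫ r in Icc r₀ r₁, Γ (s / r) * r ^ (2 - α)) /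
        (2 * (Γ 0 * ∫ r in Icc r₀ r₁, r ^ (2 - α)) - ∫ r in Icc r₀ r₁, Γ (s / r) * r ^ (2 - α)))
      (𝓝[>] 0) (𝓝 ((∫ u in (0 : ℝ)..r₁, Γ (s / u) * u ^ (2 - α)) /
        ∫ u in (0 : ℝ)..r₁, (2 * Γ 0 - Γ (s / u)) * u ^ (2 - α))) := by
  have hlim : ∀ f : ℝ → ℝ, IntervalIntegrable f volume 0 r₁ →
      Tendsto (fun r₀ => ∫ r in Icc r₀ r₁, f r) (𝓝[>] 0) (𝓝 (∫ u in (0 : ℝ)..r₁, f u)) := by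
    intro f hf
    have hc := intervalIntegral.continuousOn_primitive_interval' hf right_mem_uIcc 0 left_mem_uIcc
    rw [uIcc_of_le hr₁.le] at hc
    have hc' := (hc.mono_left (nhdsWithin_mono 0 (Ioc_subset_Icc_self))).neg
    rw [nhdsWithin_Ioc_eq_nhdsGT hr₁, ← intervalIntegral.integral_symm] at hc'
    refine hc'.congr' ?_
    filter_upwards [Ioc_mem_nhdsGT hr₁] with r₀ hr₀
    rw [← intervalIntegral.integral_symm, intervalIntegral.integral_of_le hr₀.2,
      integral_Icc_eq_integral_Ioc]
  have h1 := intervalIntegral.intervalIntegrable_rpow' (a := 0) (b := r₁) (r := 2 - α)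
    (by linarith)
  have h2 := hΓ.intervalIntegrable_mul hα le_rfl hr₁.le s
  have hden : ∫ u in (0 : ℝ)..r₁, (2 * Γ 0 - Γ (s / u)) * u ^ (2 - α) =
      2 * (Γ 0 * ∫ u in (0 : ℝ)..r₁, u ^ (2 - α)) -
        ∫ u in (0 : ℝ)..r₁, Γ (s / u) * u ^ (2 - α) := by
    rw [← mul_assoc, ← intervalIntegral.integral_const_mul,
      ← intervalIntegral.integral_sub (h1.const_mul _) h2]
    congr 1
    ext u; ring
  have hpos := hΓ.integral_denominator_pos hα hr₁ s
  rw [hden] at hpos ⊢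
  exact (hlim _ h2).div ((((hlim _ h1).const_mul _).const_mul 2).sub (hlim _ h2)) hpos.ne'

/-- The complement of the limiting ratio, as a function of `w = s / r` alone. -/
theorem one_sub_ratio_eq (hΓ : IsRadialProfile Γ) (hα : α < 3) {r s : ℝ} (hr : 0 < r) (hs : 0 < s) :
    1 - (∫ u in (0 : ℝ)..r, Γ (s / u) * u ^ (2 - α)) /
        ∫ u in (0 : ℝ)..r, (2 * Γ 0 - Γ (s / u)) * u ^ (2 - α) =
      2 * ((s / r) ^ (3 - α) * deficit Γ α (s / r)⁻¹) /
        (Γ 0 / (3 - α) + (s / r) ^ (3 - α) * deficit Γ α (s / r)⁻¹) := by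
  have hD := hΓ.integral_denominator hα hr.le s
  have hpos := hΓ.integral_denominator_pos hα hr s
  have hsub : (∫ u in (0 : ℝ)..r, (2 * Γ 0 - Γ (s / u)) * u ^ (2 - α)) -
      ∫ u in (0 : ℝ)..r, Γ (s / u) * u ^ (2 - α) =
      2 * ∫ u in (0 : ℝ)..r, (Γ 0 - Γ (s / u)) * u ^ (2 - α) := by
    have h1 := hΓ.intervalIntegrable_sub_mul hα le_rfl hr.le s
    have h2 := hΓ.intervalIntegrable_mul hα le_rfl hr.le s
    have h3 := intervalIntegral.integral_add h1 (h1.add h2)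
    have h4 := intervalIntegral.integral_add h1 h2
    have e : (fun u : ℝ => (2 * Γ 0 - Γ (s / u)) * u ^ (2 - α)) = fun u =>
        (Γ 0 - Γ (s / u)) * u ^ (2 - α) +
          ((Γ 0 - Γ (s / u)) * u ^ (2 - α) + Γ (s / u) * u ^ (2 - α)) := by
      ext u; ring
    rw [e]
    linarith
  rw [one_sub_div hpos.ne', hsub, hD,
    integral_div_mul_rpow (fun t => Γ 0 - Γ t) hs hr.le, inv_div,
    show (2 : ℝ) - α + 1 = 3 - α by ring, Real.div_rpow hs.le hr.le]
  have hr' : 0 < r ^ (3 - α) := Real.rpow_pos_of_pos hr _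
  change 2 * (s ^ (3 - α) * deficit Γ α (r / s)) / (_ + s ^ (3 - α) * deficit Γ α (r / s)) = _
  rw [← mul_div_mul_left _ (Γ 0 / (3 - α) + _) hr'.ne']
  congr 1
  · field_simp
  · field_simp

/-- If `w ^ (3 - α)` times the deficit is equivalent to a function that tends to `0`, then the
complement of the limiting ratio is equivalent to a multiple of this function. -/
theorem isEquivalent_one_sub_ratio (hΓ : IsRadialProfile Γ) (hα : α < 3) {h : ℝ → ℝ}
    (hh : (fun w : ℝ => w ^ (3 - α) * deficit Γ α w⁻¹) ~[𝓝[>] 0] h)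
    (h0 : Tendsto h (𝓝[>] 0) (𝓝 0)) :
    (fun w : ℝ => 2 * (w ^ (3 - α) * deficit Γ α w⁻¹) /
        (Γ 0 / (3 - α) + w ^ (3 - α) * deficit Γ α w⁻¹)) ~[𝓝[>] 0]
      fun w => 2 * (3 - α) / Γ 0 * h w := by
  have h3 : 0 < 3 - α := by linarith
  have hG := hΓ.zero_pos
  have hc : Γ 0 / (3 - α) ≠ 0 := by positivity
  have hH := hh.symm.tendsto_nhds h0
  have hden : (fun w : ℝ => Γ 0 / (3 - α) + w ^ (3 - α) * deficit Γ α w⁻¹) ~[𝓝[>] 0]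
      fun _ => Γ 0 / (3 - α) :=
    (Asymptotics.isEquivalent_const_iff_tendsto hc).2 (by simpa using hH.const_add (Γ 0 / (3 - α)))
  have h2 : (fun w : ℝ => 2 * (w ^ (3 - α) * deficit Γ α w⁻¹)) ~[𝓝[>] 0] fun w => 2 * h w :=
    (Asymptotics.IsEquivalent.refl (u := fun _ : ℝ => (2 : ℝ))).mul hh
  refine (h2.div hden).congr_right (Eventually.of_forall fun w => ?_)
  change 2 * h w / (Γ 0 / (3 - α)) = _
  field_simp

/-- The first-order condition at `0` makes the deficit converge. -/
theorem integrableOn_deficit (hΓ : IsRadialProfile Γ) (hα : α < 3) {ε : ℝ} (hε : ε < α - 2)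
    (ho : (fun s => Γ 0 - Γ s) =O[𝓝[>] 0] fun s => s ^ (1 - ε)) :
    IntegrableOn (fun v : ℝ => (Γ 0 - Γ (1 / v)) * v ^ (2 - α)) (Ioi 0) := by
  obtain ⟨C, hC⟩ := ho.bound
  have hinv : Tendsto (fun v : ℝ => 1 / v) atTop (𝓝[>] 0) := by
    simpa only [one_div] using tendsto_inv_atTop_nhdsGT_zero
  obtain ⟨V, hV⟩ := eventually_atTop.1 ((hinv.eventually hC).and (eventually_gt_atTop 0))
  have hV0 : 0 < V := (hV V le_rfl).2
  have hm := hΓ.measurable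
  rw [← Ioc_union_Ioi_eq_Ioi hV0.le]
  refine IntegrableOn.union ?_ ?_
  · have := hΓ.intervalIntegrable_sub_mul hα le_rfl hV0.le 1
    rwa [intervalIntegrable_iff_integrableOn_Ioc_of_le hV0.le] at this
  · refine ((integrableOn_Ioi_rpow_of_lt (a := -1 + ε + (2 - α)) (by linarith) hV0).const_mul
      C).mono' (by fun_prop) ?_
    filter_upwards [ae_restrict_mem measurableSet_Ioi] with v hv
    have hv0 : 0 < v := hV0.trans hv
    have h1 := (hV v (le_of_lt hv)).1
    rw [Real.norm_of_nonneg (Real.rpow_nonneg (by positivity) _), one_div, Real.inv_rpow hv0.le,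
      ← Real.rpow_neg hv0.le, neg_sub', sub_neg_eq_add] at h1
    rw [norm_mul, Real.norm_of_nonneg (Real.rpow_nonneg hv0.le (2 - α)), Real.rpow_add hv0,
      ← mul_assoc, one_div]
    exact mul_le_mul_of_nonneg_right h1 (Real.rpow_nonneg hv0.le _)

theorem integral_deficit_pos (hΓ : IsRadialProfile Γ)
    (hint : IntegrableOn (fun v : ℝ => (Γ 0 - Γ (1 / v)) * v ^ (2 - α)) (Ioi 0)) :
    0 < ∫ v in Ioi (0 : ℝ), (Γ 0 - Γ (1 / v)) * v ^ (2 - α) := by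
  obtain ⟨l, hl, hl0⟩ := hΓ.exists_eq_zero
  rw [setIntegral_pos_iff_support_of_nonneg_ae ?_ hint]
  · have h1 : 0 < volume (Ioo 0 (1 / l)) := by simpa using hl
    refine h1.trans_le (measure_mono fun v hv => ⟨?_, hv.1⟩)
    have h2 : l < 1 / v := (lt_one_div hl hv.1).2 hv.2
    have h3 := Real.rpow_pos_of_pos hv.1 (2 - α)
    rw [Function.mem_support, hl0 _ h2, sub_zero]
    exact (mul_pos hΓ.zero_pos h3).ne'
  · filter_upwards [ae_restrict_mem measurableSet_Ioi] with v hv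
    exact mul_nonneg (hΓ.sub_nonneg _) (Real.rpow_nonneg (le_of_lt hv) _)

/-- A negative slope at `0` determines the tail of the integrand of the deficit. -/
theorem isEquivalent_deficit (hΓ : IsRadialProfile Γ) {D : ℝ} (hα : α ≤ 2) (hD : 0 < D)
    (hd : HasDerivWithinAt Γ (-D) (Ici 0) 0) :
    deficit Γ α ~[atTop] fun T => ∫ v in (1 : ℝ)..T, D * v ^ (1 - α) := by
  have hint : ∀ s t : ℝ, 1 ≤ s → 1 ≤ t →
      IntervalIntegrable (fun v => D * v ^ (1 - α)) volume s t := fun s t hs ht =>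
    (intervalIntegral.intervalIntegrable_rpow (Or.inr fun h0 => by
      have := (le_min hs ht).trans h0.1; linarith)).const_mul D
  refine isEquivalent_intervalIntegral
    (fun s t hs ht => hΓ.intervalIntegrable_sub_mul (by linarith) hs ht 1) hint
    (fun t ht => by positivity) ?_ ?_
  · have h1 : Tendsto (fun v : ℝ => (Γ 0 - Γ (1 / v)) * v) atTop (𝓝 D) := by
      have hs := hasDerivWithinAt_iff_tendsto_slope.1 hd
      have hinv : Tendsto (fun v : ℝ => 1 / v) atTop (𝓝[Ici 0 \ {0}] 0) := by
        have : Ici (0 : ℝ) \ {0} = Ioi 0 := Ici_sdiff_left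
        rw [this]
        simpa only [one_div] using tendsto_inv_atTop_nhdsGT_zero
      have := (hs.comp hinv).neg
      rw [neg_neg] at this
      refine this.congr fun v => ?_
      simp only [Function.comp, slope, vsub_eq_sub, smul_eq_mul, sub_zero, one_div, inv_inv]
      ring
    have h2 := (Asymptotics.isEquivalent_const_iff_tendsto hD.ne').2 h1
    refine (h2.mul (Asymptotics.IsEquivalent.refl (u := fun v : ℝ => v ^ (1 - α)))).congr_left ?_
    filter_upwards [eventually_gt_atTop 0] with v hv
    simp only [Pi.mul_apply]
    rw [mul_assoc, show (2 : ℝ) - α = 1 + (1 - α) by ring, Real.rpow_add hv, Real.rpow_one]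
  -- The integral diverges, since `v ^ (1 - α) ≥ v⁻¹` for `v ≥ 1`.
  · have hlog : Tendsto (fun T : ℝ => D * Real.log T) atTop atTop :=
      Real.tendsto_log_atTop.const_mul_atTop hD
    refine tendsto_atTop_mono' _ ?_ hlog
    filter_upwards [eventually_ge_atTop 1] with T hT
    have h3 : Real.log T = ∫ v in (1 : ℝ)..T, v ^ (-1 : ℝ) := by
      simp only [Real.rpow_neg_one]
      rw [integral_inv_of_pos one_pos (by linarith), div_one]
    rw [h3, ← intervalIntegral.integral_const_mul]
    refine intervalIntegral.integral_mono_on hT ((intervalIntegral.intervalIntegrable_rpow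
      (Or.inr fun h0 => ?_)).const_mul D) (hint 1 T le_rfl hT) fun v hv => ?_
    · rw [uIcc_of_le hT] at h0
      linarith [h0.1]
    · exact mul_le_mul_of_nonneg_left (Real.rpow_le_rpow_of_exponent_le hv.1 (by linarith)) hD.le

end IsRadialProfile

/-! ### Small-distance asymptotics -/

namespace IsRadialProfile

variable {Γ : ℝ → ℝ} {α : ℝ}

theorem isEquivalent_of_integrableOn (hΓ : IsRadialProfile Γ) (hα : α < 3)
    (hint : IntegrableOn (fun v : ℝ => (Γ 0 - Γ (1 / v)) * v ^ (2 - α)) (Ioi 0)) :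
    (fun w : ℝ => w ^ (3 - α) * deficit Γ α w⁻¹) ~[𝓝[>] 0]
        (fun w => (∫ v in Ioi (0 : ℝ), (Γ 0 - Γ (1 / v)) * v ^ (2 - α)) * w ^ (3 - α)) ∧
      Tendsto (fun w : ℝ => (∫ v in Ioi (0 : ℝ), (Γ 0 - Γ (1 / v)) * v ^ (2 - α)) * w ^ (3 - α))
        (𝓝[>] 0) (𝓝 0) := by
  set K := ∫ v in Ioi (0 : ℝ), (Γ 0 - Γ (1 / v)) * v ^ (2 - α) with hK
  have hK0 : 0 < K := hΓ.integral_deficit_pos hint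
  have h1 : Tendsto (fun w : ℝ => deficit Γ α w⁻¹) (𝓝[>] 0) (𝓝 K) :=
    intervalIntegral_tendsto_integral_Ioi 0 hint tendsto_inv_nhdsGT_zero
  have h2 := (Asymptotics.isEquivalent_const_iff_tendsto hK0.ne').2 h1
  constructor
  · refine ((Asymptotics.IsEquivalent.refl (u := fun w : ℝ => w ^ (3 - α))).mul h2).congr_right
      (Eventually.of_forall fun w => mul_comm _ _)
  · have h3 : Tendsto (fun w : ℝ => w ^ (3 - α)) (𝓝[>] 0) (𝓝 0) := by
      have := (Real.continuousAt_rpow_const 0 (3 - α) (Or.inr (by linarith))).tendsto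
      rw [Real.zero_rpow (by linarith)] at this
      exact this.mono_left nhdsWithin_le_nhds
    simpa using h3.const_mul K

theorem isEquivalent_of_slope_two (hΓ : IsRadialProfile Γ) {D : ℝ} (hD : 0 < D)
    (hd : HasDerivWithinAt Γ (-D) (Ici 0) 0) :
    (fun w : ℝ => w ^ (3 - 2 : ℝ) * deficit Γ 2 w⁻¹) ~[𝓝[>] 0] (fun w => -D * (w * Real.log w)) ∧
      Tendsto (fun w : ℝ => -D * (w * Real.log w)) (𝓝[>] 0) (𝓝 0) := by
  have h1 := (hΓ.isEquivalent_deficit le_rfl hD hd).comp_tendsto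
    (tendsto_inv_nhdsGT_zero (𝕜 := ℝ))
  constructor
  · refine ((Asymptotics.IsEquivalent.refl (u := fun w : ℝ => w ^ (3 - 2 : ℝ))).mul
      h1).congr_right ?_
    filter_upwards [self_mem_nhdsWithin] with w hw
    have hw0 : 0 < w := hw
    simp only [Pi.mul_apply, Function.comp]
    rw [intervalIntegral.integral_const_mul, show (1 : ℝ) - 2 = -1 by norm_num,
      show (3 : ℝ) - 2 = 1 by norm_num, Real.rpow_one]
    simp only [Real.rpow_neg_one]
    rw [integral_inv_of_pos one_pos (inv_pos.2 hw0), div_one, Real.log_inv]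
    ring
  · have h2 : Tendsto (fun w : ℝ => w * Real.log w) (𝓝[>] 0) (𝓝 0) := by
      have := (Real.continuous_mul_log.tendsto 0).mono_left (nhdsWithin_le_nhds (s := Ioi 0))
      simpa using this
    simpa using h2.const_mul (-D)

theorem isEquivalent_of_slope_lt_two (hΓ : IsRadialProfile Γ) (hα : α < 2) {D : ℝ} (hD : 0 < D)
    (hd : HasDerivWithinAt Γ (-D) (Ici 0) 0) :
    (fun w : ℝ => w ^ (3 - α) * deficit Γ α w⁻¹) ~[𝓝[>] 0] (fun w => D / (2 - α) * w) ∧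
      Tendsto (fun w : ℝ => D / (2 - α) * w) (𝓝[>] 0) (𝓝 0) := by
  have hα' : 0 < 2 - α := by linarith
  have hpow : (fun T : ℝ => ∫ v in (1 : ℝ)..T, D * v ^ (1 - α)) ~[atTop]
      fun T => D / (2 - α) * T ^ (2 - α) := by
    have hT : (fun T : ℝ => T ^ (2 - α) - 1) ~[atTop] fun T => T ^ (2 - α) := by
      refine (Asymptotics.IsEquivalent.refl).sub_isLittleO ?_
      exact (Asymptotics.isLittleO_const_left.2
        (Or.inr (tendsto_norm_atTop_atTop.comp (tendsto_rpow_atTop hα'))))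
    refine ((Asymptotics.IsEquivalent.refl (u := fun _ : ℝ => D / (2 - α))).mul hT).congr_left
      (Eventually.of_forall fun T => ?_)
    simp only [Pi.mul_apply]
    rw [intervalIntegral.integral_const_mul, integral_rpow (Or.inl (by linarith)),
      show (1 : ℝ) - α + 1 = 2 - α by ring, Real.one_rpow]
    ring
  have h1 := ((hΓ.isEquivalent_deficit hα.le hD hd).trans hpow).comp_tendsto
    (tendsto_inv_nhdsGT_zero (𝕜 := ℝ))
  constructor
  · refine ((Asymptotics.IsEquivalent.refl (u := fun w : ℝ => w ^ (3 - α))).mul h1).congr_right ?_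
    filter_upwards [self_mem_nhdsWithin] with w hw
    have hw0 : 0 < w := hw
    have hne : w ^ (2 - α) ≠ 0 := (Real.rpow_pos_of_pos hw0 _).ne'
    simp only [Pi.mul_apply, Function.comp]
    rw [Real.inv_rpow hw0.le, show (3 : ℝ) - α = 1 + (2 - α) by ring, Real.rpow_add hw0,
      Real.rpow_one]
    field_simp
  · have : Tendsto (fun w : ℝ => w) (𝓝[>] 0) (𝓝 0) := nhdsWithin_le_nhds
    simpa using this.const_mul (D / (2 - α))

end IsRadialProfile

theorem HGamma1.isBigO {μ : Measure (Closeds Plane)} (h : HGamma1 μ) {ε : ℝ} (hε : 0 < ε) :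
    (fun s => radialCovariogram μ 0 - radialCovariogram μ s) =O[𝓝[>] 0] fun s => s ^ (1 - ε) := by
  have ht : Tendsto (fun s : ℝ => s • EuclideanSpace.single (0 : Fin 2) (1 : ℝ)) (𝓝[>] 0)
      (𝓝 (0 : Plane)) := by
    have : Continuous fun s : ℝ => s • (EuclideanSpace.single (0 : Fin 2) (1 : ℝ) : Plane) := by
      fun_prop
    simpa using (this.tendsto 0).mono_left nhdsWithin_le_nhds
  have h1 := ((h ε hε).comp_tendsto ht).isBigO.neg_left
  refine h1.congr' (Eventually.of_forall fun s => ?_) ?_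
  · simp [radialCovariogram]
  · filter_upwards [self_mem_nhdsWithin] with s hs
    simp [norm_smul, abs_of_pos (mem_Ioi.1 hs)]

section Covariogram

variable {μ : Measure (Closeds Plane)} [IsProbabilityMeasure μ]

theorem isRadialProfile_radialCovariogram (hY : FixedProportions μ) :
    IsRadialProfile (radialCovariogram μ) where
  measurable := measurable_radialCovariogram hY
  nonneg := radialCovariogram_nonneg hY
  le_zero := radialCovariogram_le hY
  zero_pos := radialCovariogram_zero_pos hY
  exists_eq_zero := exists_radialCovariogram_eq_zero hY

/-- The slope is negative: the covariogram is maximal at `0`, and the slope does not vanish. -/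
theorem HGamma2.hasDerivWithinAt (h : HGamma2 μ) (hY : FixedProportions μ) :
    HasDerivWithinAt (radialCovariogram μ) (radialSlope μ) (Ici 0) 0 ∧ radialSlope μ < 0 := by
  obtain ⟨d, c, C, hc, h⟩ := h
  obtain ⟨hd, hcd, -⟩ := h (EuclideanSpace.single (0 : Fin 2) (1 : ℝ)) (by simp)
  have hd' : HasDerivWithinAt (radialCovariogram μ) (d (EuclideanSpace.single 0 1)) (Ici 0) 0 := hd
  have heq : radialSlope μ = d (EuclideanSpace.single 0 1) :=
    hd'.derivWithin (uniqueDiffOn_Ici (0 : ℝ) 0 self_mem_Ici)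
  rw [← heq] at hd' hcd
  refine ⟨hd', lt_of_le_of_ne ?_ fun h0 => ?_⟩
  · have ht := hasDerivWithinAt_iff_tendsto_slope.1 hd'
    rw [Ici_sdiff_left] at ht
    refine le_of_tendsto ht ?_
    filter_upwards [self_mem_nhdsWithin] with s hs
    rw [slope_def_field, sub_zero]
    exact div_nonpos_of_nonpos_of_nonneg (sub_nonpos.2 (radialCovariogram_le hY s)) (le_of_lt hs)
  · rw [h0, abs_zero] at hcd
    exact absurd hcd (not_le.2 hc)

end Covariogram

end DeadLeaves

theorem mainTheorem7
    -- the law of the random compact set `Y`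
    (μ : Measure (Closeds Plane)) [IsProbabilityMeasure μ]
    (hY : FixedProportions μ) (hnull : NullBoundary μ) (hiso : Isotropic μ)
    (α : ℝ) (hα : 1 < α)
    -- for all admissible `r₀`, `r₁`, a dead leaves model with grain `R Y`
    (Ω : ℝ → EReal → Type*) [∀ r₀ r₁, MeasurableSpace (Ω r₀ r₁)]
    (P : ∀ r₀ r₁, Measure (Ω r₀ r₁)) [∀ r₀ r₁, IsProbabilityMeasure (P r₀ r₁)]
    (Φ : ∀ r₀ r₁, Ω r₀ r₁ → Set LeafPoint)
    (hΦ : ∀ (r₀ : ℝ) (r₁ : EReal), 0 < r₀ → (r₀ : EReal) < r₁ → (r₁ < ⊤ ∨ 3 < α) →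
      IsDeadLeavesProcess (P r₀ r₁) (grainLaw μ α r₀ r₁) (Φ r₀ r₁))
    -- the probability that the origin and `x` are in the same visible part
    (p : ℝ → EReal → Plane → ℝ)
    (hp : ∀ r₀ r₁ x, p r₀ r₁ x = visibleProb (P r₀ r₁) (Φ r₀ r₁) {0, x})
    -- its continuous prolongation at `r₀ = 0`
    (p₀ : ℝ → Plane → ℝ)
    (hp₀ : ∀ r₁ x, p₀ r₁ x = limUnder (𝓝[>] (0 : ℝ)) (fun r₀ => p r₀ (r₁ : EReal) x)) :
    (3 < α →
      IntegrableOn (fun v : ℝ => radialCovariogram μ (1 / v) * v ^ (2 - α)) (Ioi 0) ∧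
      (fun q : ℝ × Plane => p q.1 ⊤ q.2) ~[ratioAtTop]
        fun q => ((α - 3) / (2 * radialCovariogram μ 0) *
          ∫ v in Ioi (0 : ℝ), radialCovariogram μ (1 / v) * v ^ (2 - α)) *
            (‖q.2‖ / q.1) ^ (3 - α)) ∧
    (α < 3 → ∀ (r₁ : ℝ) (x : Plane), 0 < r₁ →
      Tendsto (fun r₀ => p r₀ (r₁ : EReal) x) (𝓝[>] 0) (𝓝 (p₀ r₁ x)) ∧
      p₀ r₁ x = (∫ u in (0 : ℝ)..r₁, radialCovariogram μ (‖x‖ / u) * u ^ (2 - α)) /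
        ∫ u in (0 : ℝ)..r₁,
          (2 * radialCovariogram μ 0 - radialCovariogram μ (‖x‖ / u)) * u ^ (2 - α)) ∧
    (2 < α → α < 3 → HGamma1 μ →
      IntegrableOn (fun v : ℝ =>
        (radialCovariogram μ 0 - radialCovariogram μ (1 / v)) * v ^ (2 - α)) (Ioi 0) ∧
      (fun q : ℝ × Plane => 1 - p₀ q.1 q.2) ~[ratioAtZero]
        fun q => (2 * (3 - α) / radialCovariogram μ 0 *
          ∫ v in Ioi (0 : ℝ),
            (radialCovariogram μ 0 - radialCovariogram μ (1 / v)) * v ^ (2 - α)) *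
              (‖q.2‖ / q.1) ^ (3 - α)) ∧
    (α = 2 → HGamma2 μ →
      (fun q : ℝ × Plane => 1 - p₀ q.1 q.2) ~[ratioAtZero]
        fun q => 2 * radialSlope μ / radialCovariogram μ 0 *
          ((‖q.2‖ / q.1) * Real.log (‖q.2‖ / q.1))) ∧
    (α < 2 → HGamma2 μ →
      (fun q : ℝ × Plane => 1 - p₀ q.1 q.2) ~[ratioAtZero]
        fun q => 2 * (3 - α) * radialSlope μ / ((α - 2) * radialCovariogram μ 0) *
          (‖q.2‖ / q.1)) := by
  have hΓ := isRadialProfile_radialCovariogram hY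
  have hprob : ∀ (r₀ : ℝ) (r₁ : EReal) (x : Plane), 0 < r₀ → (r₀ : EReal) < r₁ →
      (r₁ < ⊤ ∨ 3 < α) → p r₀ r₁ x =
        (∫ r in sizeRange r₀ r₁, radialCovariogram μ (‖x‖ / r) * r ^ (2 - α)) /
          (2 * (radialCovariogram μ 0 * ∫ r in sizeRange r₀ r₁, r ^ (2 - α)) -
            ∫ r in sizeRange r₀ r₁, radialCovariogram μ (‖x‖ / r) * r ^ (2 - α)) := by
    intro r₀ r₁ x h₀ h₀₁ h
    rw [hp, visibleProb_eq hY hnull hiso hα h₀ h₀₁ h (hΦ r₀ r₁ h₀ h₀₁ h), mixedCovariogram_zero]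
    rfl
  have hlim : α < 3 → ∀ (r₁ : ℝ) (x : Plane), 0 < r₁ →
      Tendsto (fun r₀ => p r₀ (r₁ : EReal) x) (𝓝[>] 0)
        (𝓝 ((∫ u in (0 : ℝ)..r₁, radialCovariogram μ (‖x‖ / u) * u ^ (2 - α)) /
          ∫ u in (0 : ℝ)..r₁,
            (2 * radialCovariogram μ 0 - radialCovariogram μ (‖x‖ / u)) * u ^ (2 - α))) := by
    intro hα3 r₁ x hr₁
    refine (hΓ.tendsto_ratio hα3 hr₁ ‖x‖).congr' ?_
    filter_upwards [Ioo_mem_nhdsGT hr₁] with r₀ hr₀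
    rw [hprob r₀ r₁ x hr₀.1 (EReal.coe_lt_coe_iff.2 hr₀.2) (Or.inl (EReal.coe_lt_top r₁)),
      sizeRange_coe]
  have hp₀_eq : α < 3 → ∀ (r₁ : ℝ) (x : Plane), 0 < r₁ → p₀ r₁ x =
      (∫ u in (0 : ℝ)..r₁, radialCovariogram μ (‖x‖ / u) * u ^ (2 - α)) /
        ∫ u in (0 : ℝ)..r₁,
          (2 * radialCovariogram μ 0 - radialCovariogram μ (‖x‖ / u)) * u ^ (2 - α) :=
    fun hα3 r₁ x hr₁ => (hp₀ r₁ x).trans (hlim hα3 r₁ x hr₁).limUnder_eq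
  have hratio : Tendsto (fun q : ℝ × Plane => ‖q.2‖ / q.1) ratioAtZero (𝓝[>] 0) :=
    tendsto_comap.mono_left inf_le_left
  have hcompl : α < 3 → ∀ h : ℝ → ℝ,
      ((fun w : ℝ => w ^ (3 - α) * deficit (radialCovariogram μ) α w⁻¹) ~[𝓝[>] 0] h ∧
        Tendsto h (𝓝[>] 0) (𝓝 0)) →
      (fun q : ℝ × Plane => 1 - p₀ q.1 q.2) ~[ratioAtZero]
        fun q => 2 * (3 - α) / radialCovariogram μ 0 * h (‖q.2‖ / q.1) := by
    rintro hα3 h ⟨hh, h0⟩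
    refine ((hΓ.isEquivalent_one_sub_ratio hα3 hh h0).comp_tendsto hratio).congr_left ?_
    have hpos : ∀ᶠ q : ℝ × Plane in ratioAtZero, 0 < q.1 :=
      mem_inf_of_right (mem_principal_self _)
    filter_upwards [hpos, hratio.eventually self_mem_nhdsWithin] with q hq hq2
    have hs : 0 < ‖q.2‖ := (div_pos_iff_of_pos_right hq).1 hq2
    rw [hp₀_eq hα3 q.1 q.2 hq, hΓ.one_sub_ratio_eq hα3 hq hs]
    rfl
  refine ⟨fun hα3 => ⟨hΓ.integrableOn_Ioi hα3, ?_⟩, fun hα3 r₁ x hr₁ => ?_,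
    fun hα2 hα3 hγ => ?_, fun hα2 hγ => ?_, fun hα2 hγ => ?_⟩
  · have htop : Tendsto (fun q : ℝ × Plane => ‖q.2‖ / q.1) ratioAtTop atTop :=
      tendsto_comap.mono_left inf_le_left
    refine ((hΓ.isEquivalent_ratio_top hα3
      (∫ v in Ioi (0 : ℝ), radialCovariogram μ (1 / v) * v ^ (2 - α))).comp_tendsto
        htop).congr_left ?_
    obtain ⟨l, hl, hl'⟩ := hΓ.exists_ratio_eq_top hα3
    have hpos : ∀ᶠ q : ℝ × Plane in ratioAtTop, 0 < q.1 :=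
      mem_inf_of_right (mem_principal_self _)
    filter_upwards [hpos, htop.eventually_gt_atTop l] with q hq hq2
    rw [hprob q.1 ⊤ q.2 hq (EReal.coe_lt_top _) (Or.inr hα3), sizeRange_top, hl' _ _ hq hq2]
    rfl
  · rw [hp₀_eq hα3 r₁ x hr₁]
    exact ⟨hlim hα3 r₁ x hr₁, rfl⟩
  · -- Any exponent `ε` strictly between `0` and `α - 2` gives convergence.
    have hint := hΓ.integrableOn_deficit hα3 (ε := (α - 2) / 2) (by linarith)
      (hγ.isBigO (by linarith))
    refine ⟨hint, (hcompl hα3 _ (hΓ.isEquivalent_of_integrableOn hα3 hint)).congr_right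
      (Eventually.of_forall fun q => ?_)⟩
    simp only [mul_assoc]
  · subst hα2
    obtain ⟨hd, hneg⟩ := hγ.hasDerivWithinAt hY
    rw [← neg_neg (radialSlope μ)] at hd
    refine (hcompl (by norm_num) _ (hΓ.isEquivalent_of_slope_two (neg_pos.2 hneg) hd)).congr_right
      (Eventually.of_forall fun q => ?_)
    simp only
    ring
  · obtain ⟨hd, hneg⟩ := hγ.hasDerivWithinAt hY
    rw [← neg_neg (radialSlope μ)] at hd
    refine (hcompl (by linarith) _
      (hΓ.isEquivalent_of_slope_lt_two hα2 (neg_pos.2 hneg) hd)).congr_right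
      (Eventually.of_forall fun q => ?_)
    have h1 : 2 - α ≠ 0 := by linarith
    have h2 := hΓ.zero_pos.ne'
    simp only
    rw [← neg_sub 2 α]
    field_simp
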